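/- Let $r,n\ge 1$ be integers, let $q$ be an indeterminate, $\zeta=e^{2\pi i/r}$, and let $A=(\zeta^{j(i-1)})_{1\le i,j\le r}$, $\Delta=\det A$, and $B=(b_{ij})$ the adjugate matrix of $A$, so that $A^{-1}=\Delta^{-1}B$. Put $F_c(X)=\sum_{j=1}^{r}b_{cj}X^{j-1}$ for $1\le c\le r$ and $R=\mathbb{Z}[\tfrac1r][q,q^{-1},\zeta,\Delta^{-1}]$. Let $\widehat W$ be the extended affine Weyl group of type $A$: the group generated by $\rho$ and $s_0,\dots,s_{n-1}$ (indices of the $s_i$ modulo $n$; if $n=1$ there are no generators $s_i$ and $\widehat W=\langle\rho\rangle$ is infinite cyclic) with relations $s_i^2=1$; $s_is_j=s_js_i$ if $i-j\not\equiv\pm1\pmod n$; $\rho s_i=s_{i-1}\rho$; and, if $n\ge 3$, $s_is_{i+1}s_i=s_{i+1}s_is_{i+1}$. Let $\widehat{\mathcal C}^{\mathrm{aff}}_{r,n}$ be the associative unital $R$-algebra generated by $w_1,\dots,w_n$, $h_{s_0},\dots,h_{s_{n-1}}$ (no $h_{s_i}$ if $n=1$) and $h_\rho^{\pm1}$, with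 $w_0:=w_n$, the indices of the $h_{s_i}$ read modulo $n$, and the relations - $w_i^r=1$, $w_iw_j=w_jw_i$, $h_\rho w_j=w_{j-1}h_\rho$ for $1\le i,j\le n$, and $h_\rho h_\rho^{-1}=h_\rho^{-1}h_\rho=1$; - $h_\rho h_{s_i}=h_{s_{i-1}}h_\rho$ and $h_{s_i}^2=1+(q-q^{-1})h_{s_i}$ for $0\le i\le n-1$; - $h_{s_i}h_{s_j}=h_{s_j}h_{s_i}$ if $i-j\not\equiv\pm1\pmod n$, and, if $n\ge3$, $h_{s_i}h_{s_{i+1}}h_{s_i}=h_{s_{i+1}}h_{s_i}h_{s_{i+1}}$ for $0\le i\le n-1$; - for $1\le i\le n-1$, with $S_i=\Delta^{-2}\sum_{1\le c_1<c_2\le r}(\zeta^{c_2}-\zeta^{c_1})(q-q^{-1})F_{c_1}(w_i)F_{c_2}(w_{i+1})$: $h_{s_i}w_i=w_{i+1}h_{s_i}-S_i$, $h_{s_i}w_{i+1}=w_ih_{s_i}+S_i$, and $h_{s_i}w_l=w_lh_{s_i}$ for $l\ne i,i+1$. Each $\widehat w\in\widehat W$ has a reduced expression $\widehat w=\rho^k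 s_{i_1}\cdots s_{i_m}$, that is, one with $k\in\mathbb Z$ and such that no shorter product of the $s_i$ equals $s_{i_1}\cdots s_{i_m}$. Then the element $h_{\widehat w}:=h_\rho^k h_{s_{i_1}}\cdots h_{s_{i_m}}$ does not depend on the choice of the reduced expression, and $\widehat{\mathcal C}^{\mathrm{aff}}_{r,n}$ is a free $R$-module with basis $$\{\,w_1^{\alpha_1}\cdots w_n^{\alpha_n}h_{\widehat w}\;:\;0\le\alpha_1,\dots,\alpha_n\le r-1,\ \widehat w\in\widehat W\,\}.$$ -/

import Mathlib

open scoped Polynomial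

namespace AffineYokonuma

/-! ## The ground ring -/

/-- The primitive `r`-th root of unity `ζ = exp (2 π i / r)`. -/
noncomputable def zetaC (r : ℕ) : ℂ := Complex.exp (2 * Real.pi * Complex.I / r)

/-- The Vandermonde matrix with entries `ζ ^ (j (i - 1))`, `1 ≤ i, j ≤ r`; row and column numbers
are shifted by one because `Fin r` starts at `0`. -/
noncomputable def vandermondeC (r : ℕ) : Matrix (Fin r) (Fin r) ℂ :=
  Matrix.of fun i j => zetaC r ^ (((j : ℕ) + 1) * (i : ℕ))

/-- The Vandermonde determinant `Δ`. -/
noncomputable def DeltaC (r : ℕ) : ℂ := (vandermondeC r).det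

/-- The subring `ℤ[1/r, ζ, Δ⁻¹]` of `ℂ`. -/
noncomputable def coeffSubalgebra (r : ℕ) : Subalgebra ℤ ℂ :=
  Algebra.adjoin ℤ {(r : ℂ)⁻¹, zetaC r, (DeltaC r)⁻¹}

/-- `ℤ[1/r, ζ, Δ⁻¹]` as a ring. -/
abbrev Coeff (r : ℕ) : Type := coeffSubalgebra r

/-- The ground ring `R = ℤ[1/r][q, q⁻¹, ζ, Δ⁻¹]`, with `q` an indeterminate. -/
abbrev GroundRing (r : ℕ) : Type := LaurentPolynomial (Coeff r)

/-- `ζ` as an element of `ℤ[1/r, ζ, Δ⁻¹]`. -/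
noncomputable def zeta (r : ℕ) : Coeff r :=
  ⟨zetaC r, Algebra.subset_adjoin (by simp)⟩

/-- `Δ⁻¹` as an element of `ℤ[1/r, ζ, Δ⁻¹]`. -/
noncomputable def DeltaInv (r : ℕ) : Coeff r :=
  ⟨(DeltaC r)⁻¹, Algebra.subset_adjoin (by simp)⟩

/-- The Vandermonde matrix `(ζ ^ (j (i - 1)))` over `ℤ[1/r, ζ, Δ⁻¹]`. -/
noncomputable def vandermondeMat (r : ℕ) : Matrix (Fin r) (Fin r) (Coeff r) :=
  Matrix.of fun i j => zeta r ^ (((j : ℕ) + 1) * (i : ℕ))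

/-- The indeterminate `q`. -/
noncomputable def q (r : ℕ) : GroundRing r := LaurentPolynomial.T 1

/-- The inverse `q⁻¹` of the indeterminate. -/
noncomputable def qInv (r : ℕ) : GroundRing r := LaurentPolynomial.T (-1)

/-- The polynomial `F_c(X) = ∑_j b_{cj} X ^ (j - 1)`, where `(b_{ij})` is the adjugate of the
Vandermonde matrix. The number `c ∈ {1, …, r}` is represented by `c - 1 : Fin r`. -/
noncomputable def F (r : ℕ) (c : Fin r) : (GroundRing r)[X] :=
  ∑ j : Fin r, Polynomial.C (LaurentPolynomial.C ((vandermondeMat r).adjugate c j)) *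
    Polynomial.X ^ (j : ℕ)

/-- The expression
`Δ⁻² ∑_{c₁ < c₂} (ζ ^ c₂ - ζ ^ c₁) (q - q⁻¹) F_{c₁}(x) F_{c₂}(y)`, `1 ≤ c₁ < c₂ ≤ r`,
for elements `x`, `y` of an algebra over the ground ring. -/
noncomputable def crossTerm (r : ℕ) {A : Type*} [Ring A] [Algebra (GroundRing r) A]
    (x y : A) : A :=
  (LaurentPolynomial.C (DeltaInv r ^ 2) : GroundRing r) •
    ∑ c : Fin r × Fin r with c.1 < c.2,
      ((LaurentPolynomial.C (zeta r ^ ((c.2 : ℕ) + 1) - zeta r ^ ((c.1 : ℕ) + 1)) :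
          GroundRing r) * (q r - qInv r)) •
        (Polynomial.aeval x (F r c.1) * Polynomial.aeval y (F r c.2))

/-! ## The extended affine Weyl group of type `A`

Residues modulo `n` number both the simple reflections `s_0, …, s_{n-1}` and the elements
`w_1, …, w_n`; thus `w_0 = w_n`. -/

/-- Labels of the simple affine reflections `s_0, …, s_{n-1}`: the residues modulo `n` if `n ≥ 2`.
For `n = 1` there are none, the affine Weyl group being trivial. -/
abbrev Node (n : ℕ) : Type := {_i : ZMod n // 2 ≤ n}

/-- The label `i + 1` (modulo `n`). -/
def Node.next {n : ℕ} (i : Node n) : Node n := ⟨i.1 + 1, i.2⟩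

/-- The label `i - 1` (modulo `n`). -/
def Node.prev {n : ℕ} (i : Node n) : Node n := ⟨i.1 - 1, i.2⟩

/-- Generators of the extended affine Weyl group. -/
inductive WGen (n : ℕ) : Type
  | s (i : Node n)
  | rho

/-- Relators `u v⁻¹` of the extended affine Weyl group, one for each defining relation `u = v`. -/
inductive WRel (n : ℕ) : FreeGroup (WGen n) → Prop
  | sq (i : Node n) : WRel n (FreeGroup.of (.s i) * FreeGroup.of (.s i))
  | comm (i j : Node n) (h₁ : i.1 - j.1 ≠ 1) (h₂ : i.1 - j.1 ≠ -1) :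
      WRel n ((FreeGroup.of (.s i) * FreeGroup.of (.s j)) *
        (FreeGroup.of (.s j) * FreeGroup.of (.s i))⁻¹)
  | rho_s (i : Node n) :
      WRel n ((FreeGroup.of .rho * FreeGroup.of (.s i)) *
        (FreeGroup.of (.s i.prev) * FreeGroup.of .rho)⁻¹)
  | braid (h : 3 ≤ n) (i : Node n) :
      WRel n ((FreeGroup.of (.s i) * FreeGroup.of (.s i.next) * FreeGroup.of (.s i)) *
        (FreeGroup.of (.s i.next) * FreeGroup.of (.s i) * FreeGroup.of (.s i.next))⁻¹)

/-- The extended affine Weyl group `Ŵ` of type `A`, by generators and relations. -/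
abbrev ExtAffWeyl (n : ℕ) : Type := PresentedGroup {g : FreeGroup (WGen n) | WRel n g}

/-- The simple reflection `s_i` in `Ŵ`. -/
def sW {n : ℕ} (i : Node n) : ExtAffWeyl n := PresentedGroup.of (.s i)

/-- The element `ρ` of `Ŵ`. -/
def rhoW (n : ℕ) : ExtAffWeyl n := PresentedGroup.of .rho

/-- A word in the simple reflections is reduced if no shorter word represents the same element of
the affine Weyl group, i.e. if its number of letters is the Coxeter length of that element. -/
def IsReducedWord {n : ℕ} (L : List (Node n)) : Prop :=
  ∀ L' : List (Node n), (L'.map sW).prod = (L.map sW).prod → L.length ≤ L'.length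

/-- `w = ρ ^ k s_{i_1} ⋯ s_{i_m}` is a reduced expression of `w ∈ Ŵ`. -/
def IsReducedExpression {n : ℕ} (w : ExtAffWeyl n) (k : ℤ) (L : List (Node n)) : Prop :=
  w = rhoW n ^ k * (L.map sW).prod ∧ IsReducedWord L

theorem sW_mul_self {n : ℕ} (i : Node n) : sW i * sW i = 1 :=
  PresentedGroup.one_of_mem (rels := {g : FreeGroup (WGen n) | WRel n g}) (WRel.sq i)

theorem rhoW_mul_sW {n : ℕ} (i : Node n) : rhoW n * sW i = sW i.prev * rhoW n :=
  mul_inv_eq_one.mp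
    (PresentedGroup.one_of_mem (rels := {g : FreeGroup (WGen n) | WRel n g}) (WRel.rho_s i))

theorem prod_mul_rhoW {n : ℕ} (L : List (Node n)) :
    (L.map sW).prod * rhoW n = rhoW n * ((L.map Node.next).map sW).prod := by
  induction L with
  | nil => simp
  | cons i L ih =>
    have h : sW i * rhoW n = rhoW n * sW i.next := by
      rw [rhoW_mul_sW]; simp [Node.next, Node.prev]
    simp only [List.map_cons, List.prod_cons]
    rw [mul_assoc, ih, ← mul_assoc, h, mul_assoc]

theorem prod_mul_rhoW_inv {n : ℕ} (L : List (Node n)) :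
    (L.map sW).prod * (rhoW n)⁻¹ = (rhoW n)⁻¹ * ((L.map Node.prev).map sW).prod := by
  have h := prod_mul_rhoW (L.map Node.prev)
  have h' : (L.map Node.prev).map Node.next = L := by
    simp [Function.comp_def, Node.next, Node.prev]
  rw [h'] at h
  rw [mul_inv_eq_iff_eq_mul, mul_assoc, h, inv_mul_cancel_left]

theorem exists_expression {n : ℕ} (w : ExtAffWeyl n) :
    ∃ (k : ℤ) (L : List (Node n)), w = rhoW n ^ k * (L.map sW).prod := by
  have hw : w ∈ Subgroup.closure
      (Set.range (PresentedGroup.of (rels := {g : FreeGroup (WGen n) | WRel n g}))) := by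
    rw [PresentedGroup.closure_range_of]; trivial
  induction hw using Subgroup.closure_induction_right with
  | one => exact ⟨0, [], by simp⟩
  | mul_right x _ y hy ih =>
    obtain ⟨k, L, rfl⟩ := ih
    obtain ⟨g, rfl⟩ := hy
    cases g with
    | s i => exact ⟨k, L ++ [i], by simp [mul_assoc, sW]⟩
    | rho =>
      refine ⟨k + 1, L.map Node.next, ?_⟩
      change rhoW n ^ k * (L.map sW).prod * rhoW n = _
      rw [mul_assoc, prod_mul_rhoW, zpow_add_one, mul_assoc]
  | mul_inv_cancel x _ y hy ih =>
    obtain ⟨k, L, rfl⟩ := ih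
    obtain ⟨g, rfl⟩ := hy
    cases g with
    | s i =>
      refine ⟨k, L ++ [i], ?_⟩
      change rhoW n ^ k * (L.map sW).prod * (sW i)⁻¹ = _
      rw [inv_eq_of_mul_eq_one_left (sW_mul_self i)]
      simp [mul_assoc]
    | rho =>
      refine ⟨k - 1, L.map Node.prev, ?_⟩
      change rhoW n ^ k * (L.map sW).prod * (rhoW n)⁻¹ = _
      rw [mul_assoc, prod_mul_rhoW_inv, zpow_sub_one, mul_assoc]

/-- Every element of `Ŵ` has a reduced expression. -/
theorem exists_reducedExpression {n : ℕ} (w : ExtAffWeyl n) :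
    ∃ e : ℤ × List (Node n), IsReducedExpression w e.1 e.2 := by
  classical
  obtain ⟨k, L, hL⟩ := exists_expression w
  have hex : ∃ m : ℕ, ∃ L' : List (Node n),
      (L'.map sW).prod = (L.map sW).prod ∧ L'.length = m := ⟨_, L, rfl, rfl⟩
  obtain ⟨L₀, h₀, hlen⟩ := Nat.find_spec hex
  refine ⟨(k, L₀), by rw [h₀]; exact hL, fun L' h' => ?_⟩
  rw [hlen]
  exact Nat.find_min' hex ⟨L', h'.trans h₀, rfl⟩

/-! ## The algebra -/

/-- Generators `w_1, …, w_n` (with `w_n = w_0`), `h_{s_0}, …, h_{s_{n-1}}`, `h_ρ`, `h_ρ⁻¹`. -/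
inductive CGen (n : ℕ) : Type
  | w (j : ZMod n)
  | h (i : Node n)
  | rho
  | rhoInv

section Generators

variable (r : ℕ) {n : ℕ}

/-- The free generator `w_j`. -/
noncomputable def fw (j : ZMod n) : FreeAlgebra (GroundRing r) (CGen n) :=
  FreeAlgebra.ι (GroundRing r) (CGen.w j)

/-- The free generator `h_{s_i}`. -/
noncomputable def fh (i : Node n) : FreeAlgebra (GroundRing r) (CGen n) :=
  FreeAlgebra.ι (GroundRing r) (CGen.h i)

/-- The free generator `h_ρ`. -/
noncomputable def frho : FreeAlgebra (GroundRing r) (CGen n) :=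
  FreeAlgebra.ι (GroundRing r) CGen.rho

/-- The free generator `h_ρ⁻¹`. -/
noncomputable def frhoInv : FreeAlgebra (GroundRing r) (CGen n) :=
  FreeAlgebra.ι (GroundRing r) CGen.rhoInv

end Generators

/-- The defining relations. The condition `1 ≤ i ≤ n - 1` reads `i.1 ≠ 0` for residues. -/
inductive CRel (r n : ℕ) :
    FreeAlgebra (GroundRing r) (CGen n) → FreeAlgebra (GroundRing r) (CGen n) → Prop
  | w_pow (j : ZMod n) : CRel r n (fw r j ^ r) 1
  | w_comm (i j : ZMod n) : CRel r n (fw r i * fw r j) (fw r j * fw r i)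
  | rho_w (j : ZMod n) : CRel r n (frho r * fw r j) (fw r (j - 1) * frho r)
  | rho_h (i : Node n) : CRel r n (frho r * fh r i) (fh r i.prev * frho r)
  | h_comm (i j : Node n) (h₁ : i.1 - j.1 ≠ 1) (h₂ : i.1 - j.1 ≠ -1) :
      CRel r n (fh r i * fh r j) (fh r j * fh r i)
  | h_braid (hn : 3 ≤ n) (i : Node n) :
      CRel r n (fh r i * fh r i.next * fh r i) (fh r i.next * fh r i * fh r i.next)
  | h_sq (i : Node n) : CRel r n (fh r i * fh r i) (1 + (q r - qInv r) • fh r i)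
  | h_w_self (i : Node n) (hi : i.1 ≠ 0) :
      CRel r n (fh r i * fw r i.1)
        (fw r (i.1 + 1) * fh r i - crossTerm r (fw r i.1) (fw r (i.1 + 1)))
  | h_w_next (i : Node n) (hi : i.1 ≠ 0) :
      CRel r n (fh r i * fw r (i.1 + 1))
        (fw r i.1 * fh r i + crossTerm r (fw r i.1) (fw r (i.1 + 1)))
  | h_w_other (i : Node n) (hi : i.1 ≠ 0) (l : ZMod n) (h₁ : l ≠ i.1) (h₂ : l ≠ i.1 + 1) :
      CRel r n (fh r i * fw r l) (fw r l * fh r i)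
  | rho_mul_inv : CRel r n (frho r * frhoInv r) 1
  | inv_mul_rho : CRel r n (frhoInv r * frho r) 1

/-- The associative unital algebra `Ĉ^aff_{r,n}` over the ground ring, by generators and
relations. -/
abbrev CAff (r n : ℕ) : Type := RingQuot (CRel r n)

section Elements

variable (r : ℕ) {n : ℕ}

/-- The generator `w_j` of `Ĉ^aff_{r,n}`. -/
noncomputable def wC (j : ZMod n) : CAff r n :=
  RingQuot.mkAlgHom (GroundRing r) (CRel r n) (fw r j)

/-- The generator `h_{s_i}` of `Ĉ^aff_{r,n}`. -/
noncomputable def hC (i : Node n) : CAff r n :=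
  RingQuot.mkAlgHom (GroundRing r) (CRel r n) (fh r i)

/-- The invertible generator `h_ρ` of `Ĉ^aff_{r,n}`. -/
noncomputable def hRho (n : ℕ) : (CAff r n)ˣ where
  val := RingQuot.mkAlgHom (GroundRing r) (CRel r n) (frho r)
  inv := RingQuot.mkAlgHom (GroundRing r) (CRel r n) (frhoInv r)
  val_inv := by
    rw [← map_mul, RingQuot.mkAlgHom_rel (GroundRing r) CRel.rho_mul_inv, map_one]
  inv_val := by
    rw [← map_mul, RingQuot.mkAlgHom_rel (GroundRing r) CRel.inv_mul_rho, map_one]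

/-- The product `h_ρ ^ k h_{s_{i_1}} ⋯ h_{s_{i_m}}`. -/
noncomputable def hExpr (k : ℤ) (L : List (Node n)) : CAff r n :=
  ((hRho r n ^ k : (CAff r n)ˣ) : CAff r n) * (L.map (hC r)).prod

/-- The element `h_ŵ`, formed from a chosen reduced expression of `ŵ`. -/
noncomputable def hElt (w : ExtAffWeyl n) : CAff r n :=
  hExpr r (exists_reducedExpression w).choose.1 (exists_reducedExpression w).choose.2

/-- The monomial `w_1 ^ α_1 ⋯ w_n ^ α_n` with `0 ≤ α_j ≤ r - 1`; the exponent `α_j` is the value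
of `α` at the index `j - 1 : Fin n`. -/
noncomputable def wMonomial (α : Fin n → Fin r) : CAff r n :=
  (List.ofFn fun j : Fin n => wC r (((j : ℕ) + 1 : ℕ) : ZMod n) ^ (α j : ℕ)).prod

end Elements

end AffineYokonuma

namespace AffineYokonuma

/-! ## Homomorphisms out of the extended affine Weyl group -/

section Weyl

variable {n : ℕ}

/-! Independence of the reduced expression is Matsumoto's theorem (`IsReducedWord.prod_eq`) for the
subgroup generated by the s_i; the degree ρ ↦ 1, s_i ↦ 0 determines the power of ρ
(`expression_injective`). Matsumoto's theorem rests on the exchange property, obtained from an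
action of Ŵ on Ŵ × ℤ/2 (`parityAction`). For n = 2 there is no braid relation, and uniqueness of
reduced words takes its place.

Spanning: the mixed relations move every w_j to the left of the h's, at the cost of terms in the w's
alone. For h_{s_0} no such relation is imposed, but h_{s_0} = h_ρ h_{s_1} h_ρ⁻¹. Exchange and the
quadratic relation reduce words in the h's, and w_j^r = 1 bounds the exponents.

Independence: each colouring ψ of ℤ/n by the r-th roots of unity gives a representation
(`inducedRep`) on the free module with basis e_w, w ∈ Ŵ. Here ρ acts by left multiplication, w_j
multiplies e_w by the root coloured ψ(w⁻¹ j), and h_{s_i} e_w = e_{s_i w} + d (q - q⁻¹) e_w, where d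
is 1 or 0 according to whether w⁻¹ x precedes w⁻¹ (x + 1), x ≡ i, in a total order on ℤ. Invariance
of the order under translation by n suffices for the quadratic and braid relations. Comparing
colours first gives the mixed relations too: Δ⁻¹ F_c is the Lagrange polynomial of the root ζ^c, so
S_i acts on e_w by a scalar that vanishes unless the colour at i is below the colour at i + 1.

Now h_w e_1 is e_w (for w = ρ^k u, with u in the subgroup of the s_i) plus terms ρ^k u' with u'
shorter than u. In a linear relation, the coordinate at a longest w₀ involves only the coefficients
at w₀, evaluated at the r-th roots given by the colours. Varying ψ produces all points of the grid
of roots, and invertibility of the Vandermonde matrix kills the coefficients. -/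

theorem Node.ne_succ (i : Node n) (x : ZMod n) : x ≠ x + 1 := by
  have := i.2
  have : Fact (1 < n) := ⟨by omega⟩
  simp

theorem sW_inv (i : Node n) : (sW i)⁻¹ = sW i := inv_eq_of_mul_eq_one_left (sW_mul_self i)

theorem sW_mul_sW_mul (i : Node n) (w : ExtAffWeyl n) : sW i * (sW i * w) = w := by
  rw [← mul_assoc, sW_mul_self, one_mul]

theorem mul_sW_mul_sW (i : Node n) (w : ExtAffWeyl n) : w * sW i * sW i = w := by
  rw [mul_assoc, sW_mul_self, mul_one]

theorem sW_comm (i j : Node n) (h₁ : i.1 - j.1 ≠ 1) (h₂ : i.1 - j.1 ≠ -1) :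
    sW i * sW j = sW j * sW i :=
  mul_inv_eq_one.mp (PresentedGroup.one_of_mem
    (rels := {g : FreeGroup (WGen n) | WRel n g}) (WRel.comm i j h₁ h₂))

theorem sW_braid (h : 3 ≤ n) (i : Node n) :
    sW i * sW i.next * sW i = sW i.next * sW i * sW i.next :=
  mul_inv_eq_one.mp (PresentedGroup.one_of_mem
    (rels := {g : FreeGroup (WGen n) | WRel n g}) (WRel.braid h i))

/-- Homomorphisms out of `Ŵ` from images of the generators satisfying the defining relations. -/
def weylLift {G : Type*} [Group G] (s : Node n → G) (ρ : G)
    (sq : ∀ i, s i * s i = 1)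
    (comm : ∀ i j : Node n, i.1 - j.1 ≠ 1 → i.1 - j.1 ≠ -1 → s i * s j = s j * s i)
    (rho_s : ∀ i, ρ * s i = s i.prev * ρ)
    (braid : 3 ≤ n → ∀ i, s i * s i.next * s i = s i.next * s i * s i.next) :
    ExtAffWeyl n →* G :=
  PresentedGroup.toGroup (f := fun g => match g with | .s i => s i | .rho => ρ) (by
    rintro _ (⟨i⟩ | ⟨i, j, h₁, h₂⟩ | ⟨i⟩ | ⟨h, i⟩)
    · simpa using sq i
    · simp only [map_mul, map_inv, FreeGroup.lift_apply_of, mul_inv_eq_one]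
      exact comm i j h₁ h₂
    · simp only [map_mul, map_inv, FreeGroup.lift_apply_of, mul_inv_eq_one]
      exact rho_s i
    · simp only [map_mul, map_inv, FreeGroup.lift_apply_of, mul_inv_eq_one]
      exact braid h i)

section WeylLift

variable {G : Type*} [Group G] (s : Node n → G) (ρ : G) (sq comm rho_s braid)

@[simp] theorem weylLift_sW (i : Node n) :
    weylLift s ρ sq comm rho_s braid (sW i) = s i :=
  PresentedGroup.toGroup.of _

@[simp] theorem weylLift_rhoW :
    weylLift s ρ sq comm rho_s braid (rhoW n) = ρ :=
  PresentedGroup.toGroup.of _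

end WeylLift

/-- The degree `Ŵ → ℤ` with `ρ ↦ 1` and `s_i ↦ 0`. -/
def degree (n : ℕ) : ExtAffWeyl n →* Multiplicative ℤ :=
  weylLift (fun _ => 1) (Multiplicative.ofAdd 1) (by simp) (by simp) (by simp) (by simp)

theorem degree_prod (L : List (Node n)) : degree n (L.map sW).prod = 1 := by
  induction L with
  | nil => simp
  | cons i L ih =>
    rw [List.map_cons, List.prod_cons, map_mul, ih, degree, weylLift_sW, one_mul]

theorem degree_expression (k : ℤ) (L : List (Node n)) :
    degree n (rhoW n ^ k * (L.map sW).prod) = Multiplicative.ofAdd k := by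
  rw [map_mul, degree_prod, map_zpow, degree, weylLift_rhoW, mul_one, ← ofAdd_zsmul]
  simp

/-- The degree of either side recovers the exponent of ρ, which can then be cancelled. -/
theorem expression_injective {k k' : ℤ} {L L' : List (Node n)}
    (h : rhoW n ^ k * (L.map sW).prod = rhoW n ^ k' * (L'.map sW).prod) :
    k = k' ∧ (L.map sW).prod = (L'.map sW).prod := by
  have hk : k = k' := by
    have := congrArg (degree n) h
    rwa [degree_expression, degree_expression, Multiplicative.ofAdd.apply_eq_iff_eq] at this
  subst hk
  exact ⟨rfl, mul_left_cancel h⟩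

/-! ### Affine permutations -/

/-- The map exchanging `x` and `x + 1` for all integers `x ≡ i`. -/
def affSwapFun (i : ZMod n) (x : ℤ) : ℤ :=
  if (x : ZMod n) = i then x + 1 else if (x : ZMod n) = i + 1 then x - 1 else x

theorem affSwapFun_self {i : ZMod n} {x : ℤ} (h : (x : ZMod n) = i) :
    affSwapFun i x = x + 1 := if_pos h

theorem affSwapFun_next (i : Node n) {x : ℤ} (h : (x : ZMod n) = i.1 + 1) :
    affSwapFun i.1 x = x - 1 := by
  rw [affSwapFun, if_neg, if_pos h]
  rw [h]; exact (i.ne_succ _).symm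

theorem affSwapFun_other {i : ZMod n} {x : ℤ} (h₁ : (x : ZMod n) ≠ i)
    (h₂ : (x : ZMod n) ≠ i + 1) : affSwapFun i x = x := by
  rw [affSwapFun, if_neg h₁, if_neg h₂]

theorem affSwapFun_involutive (i : Node n) : Function.Involutive (affSwapFun i.1) := by
  intro x
  by_cases h₁ : (x : ZMod n) = i.1
  · rw [affSwapFun_self h₁, affSwapFun_next i (by push_cast; rw [h₁])]; ring
  by_cases h₂ : (x : ZMod n) = i.1 + 1
  · rw [affSwapFun_next i h₂, affSwapFun_self (by push_cast; rw [h₂]; ring)]; ring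
  · rw [affSwapFun_other h₁ h₂, affSwapFun_other h₁ h₂]

/-- The affine permutation of `s_i`. -/
def affSwap (i : Node n) : Equiv.Perm ℤ := (affSwapFun_involutive i).toPerm

@[simp] theorem affSwap_apply (i : Node n) (x : ℤ) : affSwap i x = affSwapFun i.1 x := rfl

/-- For distinct labels the two permutations move disjoint sets of residue classes, and each
preserves the classes fixed by the other. -/
theorem affSwap_comm (i j : Node n) (h₁ : i.1 - j.1 ≠ 1) (h₂ : i.1 - j.1 ≠ -1) :
    affSwap i * affSwap j = affSwap j * affSwap i := by
  by_cases hij : i.1 = j.1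
  · rw [Subtype.ext hij]
  have e1 : i.1 ≠ j.1 + 1 := fun h => h₁ (by rw [h]; ring)
  have e2 : j.1 ≠ i.1 + 1 := fun h => h₂ (by rw [h]; ring)
  have key : ∀ i j : Node n, i.1 ≠ j.1 → i.1 ≠ j.1 + 1 → j.1 ≠ i.1 + 1 → ∀ x : ℤ,
      ((x : ZMod n) = i.1 ∨ (x : ZMod n) = i.1 + 1) →
      affSwapFun i.1 (affSwapFun j.1 x) = affSwapFun j.1 (affSwapFun i.1 x) := by
    rintro i j hij e1 e2 x (h | h)
    · rw [affSwapFun_other (i := j.1), affSwapFun_self h, affSwapFun_other]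
      · push_cast; rw [h]; exact fun h => e2 h.symm
      · push_cast; rw [h]; simpa using hij
      · rwa [h]
      · rwa [h]
    · rw [affSwapFun_other (i := j.1), affSwapFun_next i h, affSwapFun_other]
      · push_cast; rw [h]; simpa using hij
      · push_cast; rw [h]; simpa using e1
      · rw [h]; exact fun h => e2 h.symm
      · rw [h]; simpa using hij
  ext x
  simp only [Equiv.Perm.mul_apply, affSwap_apply]
  by_cases hi : (x : ZMod n) = i.1 ∨ (x : ZMod n) = i.1 + 1
  · exact key i j hij e1 e2 x hi
  by_cases hj : (x : ZMod n) = j.1 ∨ (x : ZMod n) = j.1 + 1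
  · exact (key j i (Ne.symm hij) e2 e1 x hj).symm
  push Not at hi hj
  rw [affSwapFun_other hi.1 hi.2, affSwapFun_other hj.1 hj.2, affSwapFun_other hi.1 hi.2]

theorem ne_add_two (h : 3 ≤ n) (x : ZMod n) : x ≠ x + 1 + 1 := by
  intro hx
  have h2 : ((2 : ℕ) : ZMod n) = 0 := by
    push_cast; linear_combination -hx
  rw [ZMod.natCast_eq_zero_iff] at h2
  exact absurd (Nat.le_of_dvd (by norm_num) h2) (by omega)

theorem affSwap_braid (h : 3 ≤ n) (i : Node n) :
    affSwap i * affSwap i.next * affSwap i = affSwap i.next * affSwap i * affSwap i.next := by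
  have e1 := i.ne_succ i.1
  have e2 := i.ne_succ (i.1 + 1)
  have e3 := ne_add_two h i.1
  have a0 : ∀ y : ℤ, (y : ZMod n) = i.1 → affSwapFun i.1 y = y + 1 :=
    fun y hy => affSwapFun_self hy
  have a1 : ∀ y : ℤ, (y : ZMod n) = i.1 + 1 → affSwapFun i.1 y = y - 1 :=
    fun y hy => affSwapFun_next i hy
  have a2 : ∀ y : ℤ, (y : ZMod n) = i.1 + 1 + 1 → affSwapFun i.1 y = y := fun y hy =>
    affSwapFun_other (by rw [hy]; exact e3.symm) (by rw [hy]; exact e2.symm)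
  have b0 : ∀ y : ℤ, (y : ZMod n) = i.1 → affSwapFun i.next.1 y = y := fun y hy =>
    affSwapFun_other (by rw [hy]; exact e1) (by rw [hy]; exact e3)
  have b1 : ∀ y : ℤ, (y : ZMod n) = i.1 + 1 → affSwapFun i.next.1 y = y + 1 :=
    fun y hy => affSwapFun_self hy
  have b2 : ∀ y : ℤ, (y : ZMod n) = i.1 + 1 + 1 → affSwapFun i.next.1 y = y - 1 :=
    fun y hy => affSwapFun_next i.next hy
  ext x
  simp only [Equiv.Perm.mul_apply, affSwap_apply]
  by_cases h0 : (x : ZMod n) = i.1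
  · rw [a0 x h0, b0 x h0, a0 x h0, b1 _ (by push_cast; rw [h0]), a2 _ (by push_cast; rw [h0])]
  by_cases h1 : (x : ZMod n) = i.1 + 1
  · rw [a1 x h1, b1 x h1, b0 _ (by push_cast; rw [h1]; ring), a0 _ (by push_cast; rw [h1]; ring),
      a2 _ (by push_cast; rw [h1]), b2 _ (by push_cast; rw [h1])]
    ring
  by_cases h2 : (x : ZMod n) = i.1 + 1 + 1
  · rw [a2 x h2, b2 x h2, a1 _ (by push_cast; rw [h2]; ring), b0 _ (by push_cast; rw [h2]; ring)]
  · rw [affSwapFun_other h0 h1, affSwapFun_other (i := i.next.1) h1 h2, affSwapFun_other h0 h1,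
      affSwapFun_other (i := i.next.1) h1 h2]

/-- The action of `Ŵ` on `ℤ` by affine permutations: `ρ` is `x ↦ x - 1`, and `s_i` exchanges `x`
and `x + 1` for all `x ≡ i`. -/
def affPerm (n : ℕ) : ExtAffWeyl n →* Equiv.Perm ℤ :=
  weylLift affSwap (Equiv.subRight 1)
    (fun i => Equiv.ext fun x => affSwapFun_involutive i x)
    affSwap_comm
    (fun i => by
      ext x
      have hp : i.prev.1 = i.1 - 1 := rfl
      simp only [Equiv.Perm.mul_apply, affSwap_apply, Equiv.subRight_apply]
      by_cases h₁ : (x : ZMod n) = i.1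
      · rw [affSwapFun_self h₁, affSwapFun_self (by push_cast; rw [h₁, hp])]; ring
      by_cases h₂ : (x : ZMod n) = i.1 + 1
      · rw [affSwapFun_next i h₂, affSwapFun_next i.prev (by push_cast; rw [h₂, hp]; ring)]
      · rw [affSwapFun_other h₁ h₂, affSwapFun_other]
        · push_cast; rw [hp]; intro h; exact h₁ (by linear_combination h)
        · push_cast; rw [hp]; intro h; exact h₂ (by linear_combination h))
    affSwap_braid

@[simp] theorem affPerm_sW (i : Node n) (x : ℤ) : affPerm n (sW i) x = affSwapFun i.1 x := by
  simp [affPerm]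

@[simp] theorem affPerm_rhoW (x : ℤ) : affPerm n (rhoW n) x = x - 1 := by
  simp [affPerm]

theorem affSwapFun_add (i : ZMod n) (x : ℤ) (k : ℤ) :
    affSwapFun i (x + n * k) = affSwapFun i x + n * k := by
  simp only [affSwapFun]
  push_cast
  simp only [CharP.cast_eq_zero, zero_mul, add_zero]
  split_ifs <;> ring

theorem affPerm_add (w : ExtAffWeyl n) (x k : ℤ) :
    affPerm n w (x + n * k) = affPerm n w x + n * k := by
  obtain ⟨m, L, rfl⟩ := exists_expression w
  have hL : ∀ x, affPerm n (L.map sW).prod (x + n * k) = affPerm n (L.map sW).prod x + n * k := by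
    induction L with
    | nil => simp
    | cons i L ih => intro x; simp [ih, affSwapFun_add]
  have hρ : ∀ (m : ℤ) (x : ℤ), affPerm n (rhoW n ^ m) x = x - m := by
    intro m
    induction m with
    | zero => simp
    | succ m ih => intro x; rw [zpow_add_one, map_mul, Equiv.Perm.mul_apply, ih]; simp; ring
    | pred m ih =>
      intro x
      have := ih (x + 1)
      rw [show (-(m : ℤ)) = (-(m : ℤ) - 1) + 1 by ring, zpow_add_one, map_mul,
        Equiv.Perm.mul_apply, affPerm_rhoW, add_sub_cancel_right] at this
      rw [this]; ring
  rw [map_mul, Equiv.Perm.mul_apply, Equiv.Perm.mul_apply, hL, hρ, hρ]; ring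

theorem exists_add_mul_of_cast_eq {x y : ℤ} (h : (x : ZMod n) = y) :
    ∃ k : ℤ, x = y + n * k := by
  obtain ⟨k, hk⟩ := (ZMod.intCast_eq_intCast_iff_dvd_sub y x n).mp h.symm
  exact ⟨k, by rw [← hk]; ring⟩

theorem affPerm_cast_congr (w : ExtAffWeyl n) {x y : ℤ} (h : (x : ZMod n) = y) :
    (affPerm n w x : ZMod n) = affPerm n w y := by
  obtain ⟨k, rfl⟩ := exists_add_mul_of_cast_eq h
  rw [affPerm_add]; simp

/-- In the affine action, s_i is the only simple reflection that raises an integer x ≡ i. -/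
theorem sW_injective : Function.Injective (sW : Node n → ExtAffWeyl n) := by
  intro i j h
  obtain ⟨x, hx⟩ := ZMod.intCast_surjective i.1
  have h1 : affSwapFun i.1 x = affSwapFun j.1 x := by
    rw [← affPerm_sW, ← affPerm_sW, h]
  rw [affSwapFun_self hx] at h1
  by_contra hij
  have hij' : (x : ZMod n) ≠ j.1 := by rw [hx]; exact fun h => hij (Subtype.ext h)
  by_cases h2 : (x : ZMod n) = j.1 + 1
  · rw [affSwapFun_next j h2] at h1; omega
  · rw [affSwapFun_other hij' h2] at h1; omega

/-- For x ≡ i the left side sends x to x + 1 and the right side sends it to x + 2. -/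
theorem sW_mul_next_ne (h : 3 ≤ n) (i : Node n) : sW i * sW i.next ≠ sW i.next * sW i := by
  intro hc
  obtain ⟨x, hx⟩ := ZMod.intCast_surjective i.1
  have h1 := congrArg (fun w => affPerm n w x) hc
  simp only [map_mul, Equiv.Perm.mul_apply, affPerm_sW] at h1
  have e1 := i.ne_succ i.1
  have e3 := ne_add_two h i.1
  rw [affSwapFun_other (i := i.next.1), affSwapFun_self hx, affSwapFun_self] at h1
  · omega
  all_goals push_cast; simp only [hx, Node.next]
  · exact e1
  · exact e3

end Weyl

/-! ## The exchange property and Matsumoto's theorem -/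

section Exchange

variable {n : ℕ}

open Classical in
/-- The indicator of equality, modulo `2`. -/
noncomputable def eqIndicator {α : Type*} (x y : α) : ZMod 2 := if x = y then 1 else 0

theorem eqIndicator_self {α : Type*} (x : α) : eqIndicator x x = 1 := if_pos rfl

theorem eqIndicator_of_ne {α : Type*} {x y : α} (h : x ≠ y) : eqIndicator x y = 0 := if_neg h

theorem eqIndicator_congr {α β : Type*} {x y : α} {x' y' : β} (h : x = y ↔ x' = y') :
    eqIndicator x y = eqIndicator x' y' := by
  by_cases hx : x = y
  · rw [eqIndicator, if_pos hx, eqIndicator, if_pos (h.mp hx)]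
  · rw [eqIndicator, if_neg hx, eqIndicator, if_neg fun h' => hx (h.mpr h')]

/-- The map `(x, ε) ↦ (s_i x s_i, ε + [x = s_i])`. -/
noncomputable def reflFun (i : Node n) (p : ExtAffWeyl n × ZMod 2) : ExtAffWeyl n × ZMod 2 :=
  (sW i * p.1 * sW i, p.2 + eqIndicator p.1 (sW i))

theorem conj_eq_iff (i : Node n) (x y : ExtAffWeyl n) :
    sW i * x * sW i = y ↔ x = sW i * y * sW i := by
  constructor <;> rintro rfl <;> simp [mul_assoc, sW_mul_sW_mul, sW_mul_self]

theorem reflFun_involutive (i : Node n) : Function.Involutive (reflFun i) := by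
  rintro ⟨x, ε⟩
  have h2 : (1 : ZMod 2) + 1 = 0 := by decide
  by_cases h : x = sW i
  · subst h
    simp [reflFun, sW_mul_self, add_assoc, h2, eqIndicator_self]
  · have h' : sW i * x * sW i ≠ sW i := by
      rw [Ne, conj_eq_iff, sW_mul_self, one_mul]; exact h
    simp [reflFun, eqIndicator_of_ne h, eqIndicator_of_ne h']
    simp [mul_assoc, sW_mul_sW_mul, sW_mul_self]

/-- `reflFun` as a permutation. -/
noncomputable def reflPerm (i : Node n) : Equiv.Perm (ExtAffWeyl n × ZMod 2) :=
  (reflFun_involutive i).toPerm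

theorem reflPerm_apply (i : Node n) (p : ExtAffWeyl n × ZMod 2) :
    reflPerm i p = reflFun i p := rfl

/-- The permutation `(x, ε) ↦ (ρ x ρ⁻¹, ε)`. -/
def rhoPerm (n : ℕ) : Equiv.Perm (ExtAffWeyl n × ZMod 2) :=
  (MulAut.conj (rhoW n)).toEquiv.prodCongr (Equiv.refl _)

theorem rhoPerm_apply (p : ExtAffWeyl n × ZMod 2) :
    rhoPerm n p = (rhoW n * p.1 * (rhoW n)⁻¹, p.2) := rfl

theorem rhoW_conj (i : Node n) : rhoW n * sW i * (rhoW n)⁻¹ = sW i.prev := by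
  rw [rhoW_mul_sW, mul_inv_cancel_right]

/-- The action of `Ŵ` on `Ŵ × ℤ/2` recording, for words in the simple reflections, how often a
reflection occurs in their reflection sequence, modulo `2`. -/
noncomputable def parityAction (n : ℕ) : ExtAffWeyl n →* Equiv.Perm (ExtAffWeyl n × ZMod 2) :=
  weylLift reflPerm (rhoPerm n)
    (fun i => Equiv.ext fun x => reflFun_involutive i x)
    (fun i j h₁ h₂ => by
      have hc := sW_comm i j h₁ h₂
      ext1 ⟨x, ε⟩
      have e1 : sW i * x * sW i = sW j ↔ x = sW j := by
        rw [conj_eq_iff, hc, mul_sW_mul_sW]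
      have e2 : sW j * x * sW j = sW i ↔ x = sW i := by
        rw [conj_eq_iff, ← hc, mul_sW_mul_sW]
      simp only [Equiv.Perm.mul_apply, reflPerm_apply, reflFun, Prod.mk.injEq,
        eqIndicator_congr e1, eqIndicator_congr e2]
      refine ⟨?_, by ring⟩
      calc sW i * (sW j * x * sW j) * sW i = (sW i * sW j) * x * (sW j * sW i) := by group
        _ = (sW j * sW i) * x * (sW i * sW j) := by rw [hc]
        _ = _ := by group)
    (fun i => by
      ext1 ⟨x, ε⟩
      have e : rhoW n * x * (rhoW n)⁻¹ = sW i.prev ↔ x = sW i := by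
        rw [← rhoW_conj, mul_left_inj, mul_right_inj]
      simp only [Equiv.Perm.mul_apply, reflPerm_apply, reflFun, rhoPerm_apply, Prod.mk.injEq,
        eqIndicator_congr e, and_true]
      rw [← rhoW_conj]; group)
    (fun h i => by
      have hb := sW_braid h i
      ext1 ⟨x, ε⟩
      have e1 : sW i * x * sW i = sW i.next ↔ sW i.next * x * sW i.next = sW i := by
        rw [conj_eq_iff, conj_eq_iff, hb]
      have e2 : sW i.next * (sW i * x * sW i) * sW i.next = sW i ↔ x = sW i.next := by
        rw [conj_eq_iff, conj_eq_iff, ← hb]; simp only [mul_assoc, sW_mul_sW_mul, sW_mul_self,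
          mul_one]
      have e3 : sW i * (sW i.next * x * sW i.next) * sW i = sW i.next ↔ x = sW i := by
        rw [conj_eq_iff, conj_eq_iff, hb]; simp only [mul_assoc, sW_mul_sW_mul, sW_mul_self,
          mul_one]
      simp only [Equiv.Perm.mul_apply, reflPerm_apply, reflFun, Prod.mk.injEq,
        eqIndicator_congr e1, eqIndicator_congr e2, eqIndicator_congr e3]
      refine ⟨?_, by ring⟩
      calc sW i * (sW i.next * (sW i * x * sW i) * sW i.next) * sW i
          = (sW i * sW i.next * sW i) * x * (sW i * sW i.next * sW i) := by group
        _ = (sW i.next * sW i * sW i.next) * x * (sW i.next * sW i * sW i.next) := by rw [hb]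
        _ = _ := by group)

@[simp] theorem parityAction_sW (i : Node n) (p : ExtAffWeyl n × ZMod 2) :
    parityAction n (sW i) p = reflFun i p := by
  simp [parityAction, reflPerm_apply]

/-- The parity attached to a group element and a reflection. -/
noncomputable def parity (w x : ExtAffWeyl n) : ZMod 2 := (parityAction n w (x, 0)).2

/-- The increment of the second component does not depend on ε. It depends on the word only through
its product, since the action is one of the group. -/
theorem parityAction_prod (L : List (Node n)) (x : ExtAffWeyl n) (ε : ZMod 2) :
    parityAction n (L.map sW).prod (x, ε) =
      ((L.map sW).prod * x * (L.map sW).prod⁻¹, ε + parity (L.map sW).prod x) := by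
  induction L generalizing ε with
  | nil => simp [parity]
  | cons i L ih =>
    simp only [List.map_cons, List.prod_cons, map_mul, Equiv.Perm.mul_apply, parity] at ih ⊢
    rw [ih, ih 0]
    simp [reflFun, mul_assoc, sW_inv, add_assoc]

theorem parity_cons (i : Node n) (L : List (Node n)) (x : ExtAffWeyl n)
    (h : (L.map sW).prod * x * (L.map sW).prod⁻¹ ≠ sW i) :
    parity ((i :: L).map sW).prod x = parity (L.map sW).prod x := by
  rw [parity, List.map_cons, List.prod_cons, map_mul, Equiv.Perm.mul_apply, parityAction_prod,
    parityAction_sW, reflFun]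
  simp [eqIndicator_of_ne h]

/-- A nonzero parity means that at some letter j of L the suffix after j conjugates x to s_j. Moving
x leftwards through that suffix then cancels this letter. -/
theorem exists_deletion_of_parity_ne_zero (L : List (Node n)) (x : ExtAffWeyl n)
    (h : parity (L.map sW).prod x ≠ 0) :
    ∃ (L₁ : List (Node n)) (j : Node n) (L₂ : List (Node n)), L = L₁ ++ j :: L₂ ∧
      (L.map sW).prod * x = ((L₁ ++ L₂).map sW).prod := by
  induction L with
  | nil => simp [parity] at h
  | cons i L ih =>
    by_cases hx : (L.map sW).prod * x * (L.map sW).prod⁻¹ = sW i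
    · refine ⟨[], i, L, rfl, ?_⟩
      rw [mul_inv_eq_iff_eq_mul] at hx
      simp only [List.map_cons, List.prod_cons, List.nil_append]
      rw [mul_assoc, hx, sW_mul_sW_mul]
    · rw [parity_cons i L x hx] at h
      obtain ⟨L₁, j, L₂, rfl, e⟩ := ih h
      refine ⟨i :: L₁, j, L₂, rfl, ?_⟩
      rw [List.map_cons, List.prod_cons, mul_assoc, e]; simp

/-- The last letter acts first: it fixes s_i under conjugation and flips the parity. -/
theorem parity_mul_sW (L : List (Node n)) (i : Node n) :
    parity ((L ++ [i]).map sW).prod (sW i) = parity (L.map sW).prod (sW i) + 1 := by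
  rw [parity, List.map_append, List.prod_append, map_mul, Equiv.Perm.mul_apply]
  simp [reflFun, sW_mul_self, parityAction_prod, add_comm, eqIndicator_self]

/-- The exchange property. -/
theorem IsReducedWord.append_or_exchange {L : List (Node n)} (hL : IsReducedWord L) (i : Node n) :
    IsReducedWord (L ++ [i]) ∨
    ∃ (L₁ : List (Node n)) (j : Node n) (L₂ : List (Node n)), L = L₁ ++ j :: L₂ ∧
      (L.map sW).prod * sW i = ((L₁ ++ L₂).map sW).prod := by
  by_cases h : parity (L.map sW).prod (sW i) = 0
  · left
    intro L' hL'
    -- Parity depends only on the group element, so every word L' for it loses a letter on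
    -- multiplication by s_i. The result is a word for the element of L, whence |L| ≤ |L'| - 1.
    have h1 : parity (L'.map sW).prod (sW i) ≠ 0 := by
      rw [hL', parity_mul_sW, h]; decide
    obtain ⟨L₁, j, L₂, rfl, e⟩ := exists_deletion_of_parity_ne_zero L' _ h1
    have := hL (L₁ ++ L₂) (by
      rw [← e, hL']; simp [mul_assoc, sW_mul_self])
    simp at this ⊢; omega
  · exact .inr (exists_deletion_of_parity_ne_zero L _ h)

/-! ### Reduced words and the exchange of their last letters. -/

theorem IsReducedWord.of_length_le {L L' : List (Node n)} (hL : IsReducedWord L)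
    (h : (L'.map sW).prod = (L.map sW).prod) (hl : L'.length ≤ L.length) : IsReducedWord L' :=
  fun M hM => hl.trans (hL M (hM.trans h))

theorem IsReducedWord.length_eq {L L' : List (Node n)} (hL : IsReducedWord L)
    (hL' : IsReducedWord L') (h : (L'.map sW).prod = (L.map sW).prod) : L.length = L'.length :=
  le_antisymm (hL _ h) (hL' _ h.symm)

theorem IsReducedWord.of_append_left {A B : List (Node n)} (h : IsReducedWord (A ++ B)) :
    IsReducedWord A := by
  intro L hL
  have := h (L ++ B) (by simp [hL])
  simpa using this

theorem IsReducedWord.of_append_right {A B : List (Node n)} (h : IsReducedWord (A ++ B)) :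
    IsReducedWord B := by
  intro L hL
  have := h (A ++ L) (by simp [hL])
  simpa using this

theorem isReducedWord_nil : IsReducedWord ([] : List (Node n)) := fun _ _ => Nat.zero_le _

/-- If the element of a reduced word has the last letter `i` in some other reduced word, then
exchange produces a reduced word that is obtained by deleting a letter and appending `i`. -/
theorem IsReducedWord.exchange {L A : List (Node n)} {i : Node n} (hL : IsReducedWord L)
    (hA : IsReducedWord (A ++ [i])) (h : (L.map sW).prod = ((A ++ [i]).map sW).prod) :
    ∃ (L₁ : List (Node n)) (j : Node n) (L₂ : List (Node n)), L = L₁ ++ j :: L₂ ∧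
      ((L₁ ++ L₂ ++ [i]).map sW).prod = (L.map sW).prod ∧ IsReducedWord (L₁ ++ L₂ ++ [i]) := by
  rcases hL.append_or_exchange i with h' | ⟨L₁, j, L₂, rfl, e⟩
  · exfalso
    -- Here `L ++ [i]` and `A` represent the same element, although `A` is two letters shorter.
    have h1 := h' A (by simp [h, mul_assoc, sW_mul_self])
    have h2 := hL.length_eq hA h.symm
    simp at h1 h2; omega
  · have e' : ((L₁ ++ L₂ ++ [i]).map sW).prod = ((L₁ ++ j :: L₂).map sW).prod := by
      rw [List.map_append, List.prod_append, ← e]; simp [mul_assoc, sW_mul_self]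
    exact ⟨L₁, j, L₂, rfl, e', hL.of_length_le e' (by simp)⟩

/-- Reduced words of the same element, if all reduced words of smaller length are determined by
their elements up to `f` and the words have the same last letter, have the same `f`-product. -/
theorem prod_eq_of_same_last {M : Type*} [Monoid M] {f : Node n → M} {m : ℕ}
    (ih : ∀ L L' : List (Node n), L.length = m → IsReducedWord L → IsReducedWord L' →
      (L.map sW).prod = (L'.map sW).prod → (L.map f).prod = (L'.map f).prod)
    {A B : List (Node n)} {i : Node n} (hm : A.length = m)
    (hA : IsReducedWord (A ++ [i])) (hB : IsReducedWord (B ++ [i]))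
    (h : ((A ++ [i]).map sW).prod = ((B ++ [i]).map sW).prod) :
    ((A ++ [i]).map f).prod = ((B ++ [i]).map f).prod := by
  have h' : (A.map sW).prod = (B.map sW).prod := by simpa using h
  simp [ih A B hm hA.of_append_left hB.of_append_left h']

/-- Deleting a letter in `A ++ [i]`: either the last letter or a letter of `A`. -/
theorem append_singleton_eq_append_cons {α : Type*} {A L₁ L₂ : List α} {i j : α}
    (h : A ++ [i] = L₁ ++ j :: L₂) :
    (L₂ = [] ∧ L₁ = A ∧ j = i) ∨
      ∃ L₃, L₂ = L₃ ++ [i] ∧ A = L₁ ++ j :: L₃ := by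
  rcases List.eq_nil_or_concat L₂ with rfl | ⟨L₃, k, rfl⟩
  · left
    have := List.append_inj' h rfl
    simp at this
    exact ⟨rfl, this.1.symm, this.2.symm⟩
  · right
    have h' : A ++ [i] = (L₁ ++ j :: L₃) ++ [k] := by rw [h]; simp
    have := List.append_inj' h' rfl
    simp at this
    exact ⟨L₃, by simp [this.2], this.1⟩

/-- Exchanging t into `L ++ [s]` cannot delete the final s, as this would give s = t; so s survives
just before t. -/
theorem exists_common_of_two_descents {L A : List (Node n)} {s t : Node n} (hst : s ≠ t)
    (hL : IsReducedWord (L ++ [s])) (hA : IsReducedWord (A ++ [t]))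
    (h : ((L ++ [s]).map sW).prod = ((A ++ [t]).map sW).prod) :
    ∃ B : List (Node n), B.length + 1 = L.length ∧
      ((B ++ [s, t]).map sW).prod = ((L ++ [s]).map sW).prod ∧ IsReducedWord (B ++ [s, t]) := by
  obtain ⟨L₁, j, L₂, e, h1, h2⟩ := hL.exchange hA h
  rcases append_singleton_eq_append_cons e with ⟨rfl, rfl, rfl⟩ | ⟨L₃, rfl, rfl⟩
  · exfalso
    simp only [List.append_nil, List.map_append, List.map_cons, List.map_nil, List.prod_append,
      List.prod_singleton] at h1
    exact hst (sW_injective (mul_left_cancel h1)).symm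
  · exact ⟨L₁ ++ L₃, by simp; omega, by simpa using h1, by simpa using h2⟩

/-- Exchanging s into `L ++ [s, t]` cannot delete t, as s ≠ t, nor the displayed s, as st ≠ ts. The
deleted letter therefore lies in L. -/
theorem exists_braid_of_two_descents {L A : List (Node n)} {s t : Node n}
    (hst : sW s * sW t ≠ sW t * sW s)
    (hL : IsReducedWord (L ++ [s, t])) (hA : IsReducedWord (A ++ [s]))
    (h : ((L ++ [s, t]).map sW).prod = ((A ++ [s]).map sW).prod) :
    ∃ B : List (Node n), B.length + 1 = L.length ∧
      ((B ++ [s, t, s]).map sW).prod = ((L ++ [s, t]).map sW).prod ∧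
      IsReducedWord (B ++ [s, t, s]) := by
  have hne : t ≠ s := by rintro rfl; exact hst rfl
  obtain ⟨L₁, j, L₂, e, h1, h2⟩ := hL.exchange hA h
  rw [show L ++ [s, t] = (L ++ [s]) ++ [t] by simp] at e h1
  rcases append_singleton_eq_append_cons e with ⟨rfl, rfl, rfl⟩ | ⟨L₃, rfl, e'⟩
  · exfalso
    simp only [List.append_nil, List.map_append, List.map_cons, List.map_nil, List.prod_append,
      List.prod_singleton] at h1
    exact hne (sW_injective (mul_left_cancel h1)).symm
  rcases append_singleton_eq_append_cons e' with ⟨rfl, rfl, rfl⟩ | ⟨L₄, rfl, rfl⟩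
  · exfalso
    simp only [List.nil_append, List.map_append, List.map_cons, List.map_nil, List.prod_append,
      List.prod_singleton, mul_assoc] at h1
    exact hst (mul_left_cancel h1).symm
  · exact ⟨L₁ ++ L₄, by simp; omega, by simpa using h1, by simpa using h2⟩

/-! ### Uniqueness of reduced words for n = 2. -/

theorem IsReducedWord.head_ne {i j : Node n} {L : List (Node n)}
    (h : IsReducedWord (i :: j :: L)) : i ≠ j := by
  rintro rfl
  have := h L (by simp [sW_mul_sW_mul])
  simp at this

theorem eq_add_one_of_ne_two (hn : n = 2) {i j : ZMod n} (h : i ≠ j) : j = i + 1 := by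
  subst hn; revert i j; decide

/-- For `n = 2`, the first letter of a reduced word is a descent, and the other one is not. -/
theorem affPerm_inv_of_reduced_two (hn : n = 2) (i : Node n) (L : List (Node n))
    (h : IsReducedWord (i :: L)) (x : ℤ) (hx : (x : ZMod n) = i.1) :
    (affPerm n ((i :: L).map sW).prod)⁻¹ (x + 1) < (affPerm n ((i :: L).map sW).prod)⁻¹ x ∧
    (affPerm n ((i :: L).map sW).prod)⁻¹ (x + 1) <
      (affPerm n ((i :: L).map sW).prod)⁻¹ (x + 2) := by
  have key : ∀ y, (affPerm n ((i :: L).map sW).prod)⁻¹ y =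
      (affPerm n (L.map sW).prod)⁻¹ (affSwapFun i.1 y) := by
    intro y
    rw [List.map_cons, List.prod_cons, map_mul, mul_inv_rev, Equiv.Perm.mul_apply, ← map_inv,
      ← map_inv, sW_inv, affPerm_sW]
  have h2 : ((2 : ℤ) : ZMod n) = 0 := by subst hn; decide
  have hx2 : ((x + 2 : ℤ) : ZMod n) = i.1 := by rw [Int.cast_add, h2, hx, add_zero]
  have hx3 : (affPerm n (L.map sW).prod)⁻¹ (x + 2 + 1) =
      (affPerm n (L.map sW).prod)⁻¹ (x + 1) + 2 := by
    have hn' : (n : ℤ) = 2 := by rw [hn]; rfl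
    rw [← map_inv, show x + 2 + 1 = x + 1 + n * 1 by rw [hn']; ring, affPerm_add, hn', mul_one]
  rw [key, key, key, affSwapFun_self hx, affSwapFun_next i (by push_cast; rw [hx]),
    affSwapFun_self hx2, hx3, add_sub_cancel_right]
  -- Since s_i exchanges x with x + 1 and sends x + 2 to (x + 1) + 2, the two claims for `i :: L`
  -- become u x < u (x + 1) and u x < u (x + 1) + 2, with u the inverse of the shorter product.
  suffices hlt : (affPerm n (L.map sW).prod)⁻¹ x < (affPerm n (L.map sW).prod)⁻¹ (x + 1) from
    ⟨hlt, by omega⟩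
  cases L with
  | nil => simp
  | cons j L =>
    have hj : j.1 = i.1 + 1 := eq_add_one_of_ne_two hn fun e => h.head_ne (Subtype.ext e)
    -- The letters alternate, so the induction is applied at x - 1 ≡ j, whose second inequality
    -- compares x with x + 1.
    have := (affPerm_inv_of_reduced_two hn j L (IsReducedWord.of_append_right (A := [i]) h)
      (x + 1 - 2) (by rw [Int.cast_sub, h2, hj, ← hx]; simp)).2
    rw [show x + 1 - 2 + 1 = x by ring, show x + 1 - 2 + 2 = x + 1 by ring] at this
    exact this
termination_by L.length

/-- Two different first letters would order the same two values of the inverse affine permutation in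
opposite ways. -/
theorem isReducedWord_unique_two (hn : n = 2) {L L' : List (Node n)}
    (hL : IsReducedWord L) (hL' : IsReducedWord L')
    (h : (L.map sW).prod = (L'.map sW).prod) : L = L' := by
  induction L generalizing L' with
  | nil =>
    have := hL.length_eq hL' h.symm
    exact (List.length_eq_zero_iff.mp this.symm).symm
  | cons i L ih =>
    cases L' with
    | nil => have := hL.length_eq hL' h.symm; simp at this
    | cons j L' =>
      have hij : i = j := by
        by_contra hij
        obtain ⟨x, hx⟩ := ZMod.intCast_surjective i.1
        have hj : j.1 = i.1 + 1 := eq_add_one_of_ne_two hn fun e => hij (Subtype.ext e)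
        have h2 : ((2 : ℤ) : ZMod n) = 0 := by subst hn; decide
        have h1 := (affPerm_inv_of_reduced_two hn i L hL x hx).1
        have h3 := (affPerm_inv_of_reduced_two hn j L' hL'
          (x + 1 - 2) (by rw [Int.cast_sub, h2, hj, ← hx]; simp)).2
        rw [show x + 1 - 2 + 1 = x by ring, show x + 1 - 2 + 2 = x + 1 by ring, ← h] at h3
        exact lt_asymm h1 h3
      subst hij
      rw [ih (IsReducedWord.of_append_right (A := [i]) hL)
        (IsReducedWord.of_append_right (A := [i]) hL') (by simpa using h)]

/-- Matsumoto's theorem: functions of the simple reflections that satisfy the braid relations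
have the same product over all reduced words of the same element. -/
theorem IsReducedWord.prod_eq {M : Type*} [Monoid M] (f : Node n → M)
    (comm : ∀ i j : Node n, i.1 - j.1 ≠ 1 → i.1 - j.1 ≠ -1 → f i * f j = f j * f i)
    (braid : 3 ≤ n → ∀ i : Node n, f i * f i.next * f i = f i.next * f i * f i.next)
    {L L' : List (Node n)} (hL : IsReducedWord L) (hL' : IsReducedWord L')
    (h : (L.map sW).prod = (L'.map sW).prod) : (L.map f).prod = (L'.map f).prod := by
  obtain ⟨m, hm⟩ : ∃ m, L.length = m := ⟨_, rfl⟩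
  induction m generalizing L L' with
  | zero =>
    have hl := hL.length_eq hL' h.symm
    rw [List.length_eq_zero_iff.mp hm, List.length_eq_zero_iff.mp (hl.symm.trans hm)]
  | succ m ih =>
    have hl := hL.length_eq hL' h.symm
    rcases List.eq_nil_or_concat L with rfl | ⟨A, s, rfl⟩
    · simp at hm
    rcases List.eq_nil_or_concat L' with rfl | ⟨B, t, rfl⟩
    · simp at hl
    rw [List.concat_eq_append] at *
    rw [List.concat_eq_append] at *
    have hA : A.length = m := by simpa using hm
    have hB : B.length = m := by simp at hl; omega
    have last : ∀ {A B : List (Node n)} {i : Node n}, A.length = m →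
        IsReducedWord (A ++ [i]) → IsReducedWord (B ++ [i]) →
        ((A ++ [i]).map sW).prod = ((B ++ [i]).map sW).prod →
        ((A ++ [i]).map f).prod = ((B ++ [i]).map f).prod :=
      prod_eq_of_same_last fun L L' hm hL hL' h => ih hL hL' h hm
    by_cases hst : s = t
    · subst hst
      exact last hA hL hL' h
    obtain ⟨C, hC, h1, h2⟩ := exists_common_of_two_descents hst hL hL' h
    have key1 : ((B ++ [t]).map f).prod = ((C ++ [s, t]).map f).prod := by
      rw [show C ++ [s, t] = (C ++ [s]) ++ [t] by simp] at h1 h2 ⊢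
      exact last hB hL' h2 (by rw [h1, h])
    rw [key1]
    -- It remains to link `A ++ [s]` to `C ++ [s, t]`: a commutation or a braid move at the end of
    -- the latter yields a word ending in s.
    by_cases hc : s.1 - t.1 ≠ 1 ∧ s.1 - t.1 ≠ -1
    · have e : ((C ++ [t, s]).map sW).prod = ((C ++ [s, t]).map sW).prod := by
        simp [sW_comm s t hc.1 hc.2]
      have h2' : IsReducedWord (C ++ [t, s]) := h2.of_length_le e (by simp)
      have e' : ((C ++ [s, t]).map f).prod = ((C ++ [t, s]).map f).prod := by
        simp [comm s t hc.1 hc.2]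
      rw [e']
      rw [show C ++ [t, s] = (C ++ [t]) ++ [s] by simp] at e h2' ⊢
      exact last hA hL h2' (by rw [e, h1])
    have adj : t = s.next ∨ s = t.next := by
      rw [not_and_or, not_ne_iff, not_ne_iff] at hc
      rcases hc with hc | hc
      · right; apply Subtype.ext; simp only [Node.next]; linear_combination hc
      · left; apply Subtype.ext; simp only [Node.next]; linear_combination -hc
    have hn2 : 2 ≤ n := s.2
    rcases hn2.eq_or_lt with hn | hn
    · exact absurd (isReducedWord_unique_two hn.symm hL hL' h) fun e =>
        hst (by simpa using (List.append_inj' e rfl).2)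
    have hn3 : 3 ≤ n := hn
    have hnc : sW s * sW t ≠ sW t * sW s := by
      rcases adj with rfl | rfl
      · exact sW_mul_next_ne hn3 s
      · exact (sW_mul_next_ne hn3 t).symm
    have hbr : sW s * sW t * sW s = sW t * sW s * sW t := by
      rcases adj with rfl | rfl
      · exact sW_braid hn3 s
      · exact (sW_braid hn3 t).symm
    have hbf : f s * f t * f s = f t * f s * f t := by
      rcases adj with rfl | rfl
      · exact braid hn3 s
      · exact (braid hn3 t).symm
    obtain ⟨D, hD, h3, h4⟩ := exists_braid_of_two_descents hnc h2 hL h1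
    have e : ((D ++ [t, s, t]).map sW).prod = ((D ++ [s, t, s]).map sW).prod := by
      simp only [List.map_append, List.prod_append, List.map_cons, List.map_nil, List.prod_cons,
        List.prod_nil, mul_one, ← mul_assoc] at hbr ⊢
      simp only [mul_assoc] at hbr ⊢
      rw [hbr]
    have ef : ((D ++ [t, s, t]).map f).prod = ((D ++ [s, t, s]).map f).prod := by
      simp only [List.map_append, List.prod_append, List.map_cons, List.map_nil, List.prod_cons,
        List.prod_nil, mul_one]
      simp only [mul_assoc] at hbf ⊢
      rw [hbf]
    have h4' : IsReducedWord (D ++ [t, s, t]) := h4.of_length_le e (by simp)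
    calc ((A ++ [s]).map f).prod = ((D ++ [s, t, s]).map f).prod := by
          rw [show D ++ [s, t, s] = (D ++ [s, t]) ++ [s] by simp] at h3 h4 ⊢
          exact last hA hL h4 (by rw [h3, h1])
      _ = ((D ++ [t, s, t]).map f).prod := ef.symm
      _ = ((C ++ [s, t]).map f).prod := by
          rw [show D ++ [t, s, t] = (D ++ [t, s]) ++ [t] by simp] at e h4' ⊢
          rw [show C ++ [s, t] = (C ++ [s]) ++ [t] by simp] at h2 h3 ⊢
          exact last (by simp; omega) h4' h2 (by rw [e, h3])

end Exchange

/-! ## The Vandermonde matrix -/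

section Vandermonde

variable (r : ℕ)

/-- The nodes ζ, ζ², …, ζ^r are distinct because ζ is primitive. -/
theorem DeltaC_ne_zero (hr : 1 ≤ r) : DeltaC r ≠ 0 := by
  have hζ : IsPrimitiveRoot (zetaC r) r := Complex.isPrimitiveRoot_exp r (by omega)
  have hM : vandermondeC r =
      (Matrix.vandermonde fun j : Fin r => zetaC r ^ ((j : ℕ) + 1)).transpose := by
    ext i j
    simp [vandermondeC, Matrix.vandermonde_apply, ← pow_mul]
  rw [DeltaC, hM, Matrix.det_transpose, Matrix.det_vandermonde_ne_zero_iff]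
  intro i j h
  have h' : zetaC r ^ (i : ℕ) = zetaC r ^ (j : ℕ) := by
    simp only [pow_succ] at h
    exact mul_right_cancel₀ (hζ.ne_zero (by omega)) h
  exact Fin.ext (hζ.pow_inj i.2 j.2 h')

theorem DeltaInv_mul_det (hr : 1 ≤ r) : DeltaInv r * (vandermondeMat r).det = 1 := by
  have h : (((vandermondeMat r).det : Coeff r) : ℂ) = DeltaC r := by
    change (coeffSubalgebra r).val.toRingHom _ = _
    rw [RingHom.map_det, DeltaC]
    rfl
  apply Subtype.ext
  change (DeltaC r)⁻¹ * (((vandermondeMat r).det : Coeff r) : ℂ) = 1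
  rw [h, inv_mul_cancel₀ (DeltaC_ne_zero r hr)]

theorem zeta_pow (hr : 1 ≤ r) : zeta r ^ r = 1 :=
  Subtype.ext (Complex.isPrimitiveRoot_exp r (by omega)).pow_eq_one

/-- The `r`-th root of unity `ζ ^ c` in the ground ring, where `c` is represented by `c - 1`. -/
noncomputable def root (c : Fin r) : GroundRing r := LaurentPolynomial.C (zeta r ^ ((c : ℕ) + 1))

theorem C_zeta_sub (c d : Fin r) :
    (LaurentPolynomial.C (zeta r ^ ((d : ℕ) + 1) - zeta r ^ ((c : ℕ) + 1)) : GroundRing r) =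
      root r d - root r c := map_sub _ _ _

theorem root_pow (hr : 1 ≤ r) (c : Fin r) : root r c ^ r = 1 := by
  rw [root, ← map_pow, ← pow_mul, mul_comm, pow_mul, zeta_pow r hr, one_pow, map_one]

/-- The Vandermonde determinant in the ground ring. -/
noncomputable def Delta : GroundRing r := LaurentPolynomial.C (vandermondeMat r).det

theorem DeltaInv_mul_Delta (hr : 1 ≤ r) : LaurentPolynomial.C (DeltaInv r) * Delta r = 1 := by
  rw [Delta, ← map_mul, DeltaInv_mul_det r hr, map_one]

theorem root_pow_eq (c j : Fin r) :
    root r c ^ (j : ℕ) = LaurentPolynomial.C (vandermondeMat r j c) := by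
  rw [root, ← map_pow, vandermondeMat, Matrix.of_apply, ← pow_mul]

/-- These values are the entries of the adjugate times the Vandermonde matrix. -/
theorem eval_F (c a : Fin r) : (F r c).eval (root r a) = if c = a then Delta r else 0 := by
  simp only [F, Polynomial.eval_finsetSum, Polynomial.eval_mul, Polynomial.eval_C,
    Polynomial.eval_pow, Polynomial.eval_X, root_pow_eq, ← map_mul, ← map_sum]
  rw [← Matrix.mul_apply, Matrix.adjugate_mul, Matrix.smul_apply, Matrix.one_apply, Delta]
  split_ifs <;> simp

theorem sum_root_pow_mul_adjugate (α β : Fin r) :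
    ∑ c : Fin r, root r c ^ (α : ℕ) * LaurentPolynomial.C ((vandermondeMat r).adjugate c β) =
      if α = β then Delta r else 0 := by
  simp only [root_pow_eq, ← map_mul, ← map_sum]
  rw [← Matrix.mul_apply, Matrix.mul_adjugate, Matrix.smul_apply, Matrix.one_apply, Delta]
  split_ifs <;> simp

/-- The monomials with exponents below `r` are linearly independent on the grid of `r`-th roots
of unity. -/
theorem eq_zero_of_sum_root_pow_eq_zero (hr : 1 ≤ r) {ι : Type*} [Fintype ι] [DecidableEq ι]
    (a : (ι → Fin r) → GroundRing r)
    (h : ∀ χ : ι → Fin r, ∑ α, a α * ∏ j, root r (χ j) ^ (α j : ℕ) = 0) (β : ι → Fin r) :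
    a β = 0 := by
  -- The evaluation matrix on the grid is a tensor power of the Vandermonde matrix. Pairing with the
  -- same tensor power of the adjugate isolates a β times a power of Δ, which is a unit.
  have h1 : ∑ χ : ι → Fin r, (∑ α, a α * ∏ j, root r (χ j) ^ (α j : ℕ)) *
      ∏ j, LaurentPolynomial.C ((vandermondeMat r).adjugate (χ j) (β j)) = 0 :=
    Finset.sum_eq_zero fun χ _ => by rw [h, zero_mul]
  have h2 : ∀ α : ι → Fin r, ∑ χ : ι → Fin r, (∏ j, root r (χ j) ^ (α j : ℕ)) *
      ∏ j, LaurentPolynomial.C ((vandermondeMat r).adjugate (χ j) (β j)) =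
      if α = β then Delta r ^ Fintype.card ι else 0 := by
    intro α
    simp only [← Finset.prod_mul_distrib]
    rw [← Fintype.prod_sum fun (j : ι) (c : Fin r) => root r c ^ (α j : ℕ) *
      LaurentPolynomial.C ((vandermondeMat r).adjugate c (β j))]
    simp only [sum_root_pow_mul_adjugate]
    by_cases hαβ : α = β
    · simp [hαβ]
    · rw [if_neg hαβ]
      obtain ⟨j, hj⟩ := Function.ne_iff.mp hαβ
      exact Finset.prod_eq_zero (Finset.mem_univ j) (if_neg hj)
  simp only [Finset.sum_mul] at h1
  rw [Finset.sum_comm] at h1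
  simp only [mul_assoc, ← Finset.mul_sum, h2, mul_ite, mul_zero, Finset.sum_ite_eq',
    Finset.mem_univ, if_true] at h1
  calc a β = a β * (LaurentPolynomial.C (DeltaInv r) * Delta r) ^ Fintype.card ι := by
        rw [DeltaInv_mul_Delta r hr, one_pow, mul_one]
    _ = a β * Delta r ^ Fintype.card ι * LaurentPolynomial.C (DeltaInv r) ^ Fintype.card ι := by
        rw [mul_pow]; ring
    _ = 0 := by rw [h1, zero_mul]

theorem map_crossTerm {A B : Type*} [Ring A] [Ring B] [Algebra (GroundRing r) A]
    [Algebra (GroundRing r) B] (f : A →ₐ[GroundRing r] B) (x y : A) :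
    f (crossTerm r x y) = crossTerm r (f x) (f y) := by
  simp only [crossTerm, map_smul, map_sum, map_mul, Polynomial.aeval_algHom_apply]

theorem aeval_apply_of_eq_smul {R M : Type*} [CommRing R] [AddCommGroup M] [Module R M]
    {f : Module.End R M} {m : M} {a : R} (h : f m = a • m) (p : R[X]) :
    Polynomial.aeval f p m = p.eval a • m := by
  induction p using Polynomial.induction_on' with
  | add p q hp hq => simp [add_smul, hp, hq]
  | monomial k b =>
    have hk : (f ^ k) m = a ^ k • m := by
      induction k with
      | zero => simp
      | succ k ih => rw [pow_succ, Module.End.mul_apply, h, map_smul, ih, smul_smul, pow_succ']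
    simp [Polynomial.aeval_monomial, hk, smul_smul, mul_comm]

theorem mul_mul_eq_sq_mul {R : Type*} [CommRing R] (x y : R) : x * y * y = y ^ 2 * x := by ring

/-- `S_i` acts by a scalar on simultaneous eigenvectors of `w_i` and `w_{i+1}`. -/
theorem crossTerm_apply (hr : 1 ≤ r) {M : Type*} [AddCommGroup M] [Module (GroundRing r) M]
    {f g : Module.End (GroundRing r) M} {m : M} {a b : Fin r}
    (hf : f m = root r a • m) (hg : g m = root r b • m) :
    crossTerm r f g m =
      (if a < b then (root r b - root r a) * (q r - qInv r) else 0) • m := by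
  -- By `eval_F` only the summand (c₁, c₂) = (a, b) survives; it carries the factor Δ² and occurs in
  -- the sum exactly when a < b.
  have key : ∀ c : Fin r × Fin r, ((LaurentPolynomial.C (zeta r ^ ((c.2 : ℕ) + 1) -
      zeta r ^ ((c.1 : ℕ) + 1)) : GroundRing r) * (q r - qInv r)) •
        (Polynomial.aeval f (F r c.1) * Polynomial.aeval g (F r c.2)) m =
      (if c = (a, b) then Delta r ^ 2 * ((root r b - root r a) * (q r - qInv r)) else 0) • m := by
    rintro ⟨c, d⟩
    rw [Module.End.mul_apply, aeval_apply_of_eq_smul hg, map_smul, aeval_apply_of_eq_smul hf,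
      eval_F, eval_F, smul_smul, smul_smul, C_zeta_sub]
    by_cases hc : c = a
    · by_cases hd : d = b
      · rw [if_pos hc, if_pos hd, if_pos (by rw [hc, hd]), hc, hd]
        rw [mul_mul_eq_sq_mul]
      · rw [if_neg hd, if_neg fun h => hd (congrArg Prod.snd h)]; simp
    · rw [if_neg hc, if_neg fun h => hc (congrArg Prod.fst h)]; simp
  simp only [crossTerm, LinearMap.smul_apply, LinearMap.sum_apply, key, ← Finset.sum_smul,
    smul_smul]
  congr 1
  rw [Finset.sum_ite_eq']
  by_cases hab : a < b
  · rw [if_pos hab, if_pos (by simpa using hab), ← mul_assoc, map_pow, ← mul_pow, DeltaInv_mul_Delta r hr, one_pow, one_mul]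
  · rw [if_neg hab, if_neg (by simpa using hab), mul_zero]

end Vandermonde

/-! ## Induced representations -/

section Positions

variable {r n : ℕ} (ψ : ZMod n → Fin r)

/-- An integer representing a residue. -/
noncomputable def residueLift (j : ZMod n) : ℤ := (ZMod.intCast_surjective j).choose

@[simp] theorem residueLift_cast (j : ZMod n) : ((residueLift j : ℤ) : ZMod n) = j :=
  (ZMod.intCast_surjective j).choose_spec

/-- The action of `Ŵ` on residues. -/
noncomputable def residueAct (w : ExtAffWeyl n) (j : ZMod n) : ZMod n :=
  (affPerm n w (residueLift j) : ℤ)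

theorem residueAct_cast (w : ExtAffWeyl n) (x : ℤ) :
    residueAct w (x : ZMod n) = (affPerm n w x : ℤ) :=
  affPerm_cast_congr w (residueLift_cast _)

theorem residueAct_inv_residueAct (w : ExtAffWeyl n) (j : ZMod n) :
    residueAct w⁻¹ (residueAct w j) = j := by
  rw [residueAct.eq_def w, residueAct_cast, map_inv,
    Equiv.Perm.inv_eq_iff_eq.mpr rfl, residueLift_cast]

/-- The lexicographic position of an integer: first its colour, then its negative. -/
def lexKey (x : ℤ) : Fin r ×ₗ ℤ := toLex (ψ x, -x)

theorem lexKey_injective : Function.Injective (lexKey ψ) := fun x y h => by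
  have := congrArg (fun p => (ofLex p).2) h
  simpa [lexKey] using this

/-- This invariance makes `descent` independent of the integer representing a residue. -/
theorem lexKey_add_lt (x y k : ℤ) :
    lexKey ψ (x + n * k) < lexKey ψ (y + n * k) ↔ lexKey ψ x < lexKey ψ y := by
  simp only [lexKey, Prod.Lex.toLex_lt_toLex, Int.cast_add, Int.cast_mul, Int.cast_natCast,
    CharP.cast_eq_zero, zero_mul, add_zero, neg_lt_neg_iff, add_lt_add_iff_right]

/-- The position of `w⁻¹ x`. -/
def position (w : ExtAffWeyl n) (x : ℤ) : Fin r ×ₗ ℤ := lexKey ψ (affPerm n w⁻¹ x)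

theorem position_injective (w : ExtAffWeyl n) : Function.Injective (position ψ w) :=
  (lexKey_injective ψ).comp (affPerm n w⁻¹).injective

theorem position_sW_mul (i : Node n) (w : ExtAffWeyl n) (x : ℤ) :
    position ψ (sW i * w) x = position ψ w (affSwapFun i.1 x) := by
  simp only [position, mul_inv_rev, sW_inv, map_mul, Equiv.Perm.mul_apply, affPerm_sW]

theorem position_rhoW_mul (w : ExtAffWeyl n) (x : ℤ) :
    position ψ (rhoW n * w) x = position ψ w (x + 1) := by
  simp only [position, mul_inv_rev, map_mul, Equiv.Perm.mul_apply]
  congr 2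

/-- The colour of `w⁻¹ j`. -/
noncomputable def colour (w : ExtAffWeyl n) (j : ZMod n) : Fin r := ψ (residueAct w⁻¹ j)

theorem position_fst (w : ExtAffWeyl n) (x : ℤ) :
    (ofLex (position ψ w x)).1 = colour ψ w (x : ZMod n) := by
  simp [position, lexKey, colour, residueAct_cast]

theorem colour_eq_of_position_eq {w w' : ExtAffWeyl n} {x y : ℤ}
    (h : position ψ w x = position ψ w' y) : colour ψ w (x : ZMod n) = colour ψ w' (y : ZMod n) := by
  rw [← position_fst, ← position_fst, h]

open Classical in
/-- The coefficient of `w` in the action of `h_{s_i}` on `w`, up to the factor `q - q⁻¹`. -/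
noncomputable def descent (w : ExtAffWeyl n) (i : ZMod n) : ℕ :=
  if position ψ w (residueLift i) < position ψ w (residueLift i + 1) then 1 else 0

open Classical in
theorem descent_eq (w : ExtAffWeyl n) {i : ZMod n} {x : ℤ} (hx : (x : ZMod n) = i) :
    descent ψ w i = if position ψ w x < position ψ w (x + 1) then 1 else 0 := by
  obtain ⟨k, hk⟩ := exists_add_mul_of_cast_eq ((residueLift_cast i).trans hx.symm)
  rw [descent, hk, add_right_comm x (n * k) 1]
  simp only [position, affPerm_add, lexKey_add_lt]
  congr

/-- Passing from w to s_i w exchanges two distinct positions, so exactly one of the two comparisons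
holds. -/
theorem descent_sW_mul_self (w : ExtAffWeyl n) (i : Node n) :
    descent ψ (sW i * w) i.1 + descent ψ w i.1 = 1 := by
  have hx := residueLift_cast i.1
  have hx1 : ((residueLift i.1 + 1 : ℤ) : ZMod n) = i.1 + 1 := by push_cast; rw [hx]
  rw [descent_eq ψ _ hx, descent_eq ψ _ hx, position_sW_mul, position_sW_mul,
    affSwapFun_self hx, affSwapFun_next i hx1, add_sub_cancel_right]
  have hne : position ψ w (residueLift i.1) ≠ position ψ w (residueLift i.1 + 1) :=
    (position_injective ψ w).ne (by simp)
  rcases hne.lt_or_gt with h | h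
  · rw [if_neg h.asymm, if_pos h]
  · rw [if_neg h.asymm, if_pos h]

theorem descent_rhoW_mul (w : ExtAffWeyl n) (i : Node n) :
    descent ψ (rhoW n * w) i.prev.1 = descent ψ w i.1 := by
  have hx := residueLift_cast i.prev.1
  have hx1 : ((residueLift i.prev.1 + 1 : ℤ) : ZMod n) = i.1 := by
    push_cast; rw [hx]; simp [Node.prev]
  rw [descent_eq ψ _ hx, descent_eq ψ _ hx1, position_rhoW_mul, position_rhoW_mul]

theorem descent_sW_mul_of_comm (w : ExtAffWeyl n) (i j : Node n) (h : i ≠ j)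
    (h₁ : i.1 - j.1 ≠ 1) (h₂ : i.1 - j.1 ≠ -1) :
    descent ψ (sW i * w) j.1 = descent ψ w j.1 := by
  have hx := residueLift_cast j.1
  have hx1 : ((residueLift j.1 + 1 : ℤ) : ZMod n) = j.1 + 1 := by push_cast; rw [hx]
  have hij : j.1 ≠ i.1 := fun e => h (Subtype.ext e.symm)
  rw [descent_eq ψ _ hx, descent_eq ψ _ hx, position_sW_mul, position_sW_mul,
    affSwapFun_other, affSwapFun_other]
  · rw [hx1]; exact fun e => h₁ (by rw [← e]; ring)
  · rw [hx1]; simpa using hij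
  · rwa [hx]
  · rw [hx]; exact fun e => h₂ (by rw [e]; ring)

open Classical in
theorem descent_sW_mul_next (hn : 3 ≤ n) (w : ExtAffWeyl n) (i : Node n) {x : ℤ}
    (hx : (x : ZMod n) = i.1) : descent ψ (sW i * w) i.next.1 =
      if position ψ w x < position ψ w (x + 2) then 1 else 0 := by
  have hx1 : ((x + 1 : ℤ) : ZMod n) = i.next.1 := by push_cast; rw [hx]; rfl
  have hx2 : ((x + 1 + 1 : ℤ) : ZMod n) = i.1 + 1 + 1 := by push_cast; rw [hx]
  rw [descent_eq ψ _ hx1, position_sW_mul, position_sW_mul, affSwapFun_next i hx1,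
    affSwapFun_other, add_sub_cancel_right, add_assoc x 1 1, one_add_one_eq_two]
  · rw [hx2]; exact (ne_add_two hn i.1).symm
  · rw [hx2]; exact (i.ne_succ _).symm

open Classical in
theorem descent_sW_next_mul (hn : 3 ≤ n) (w : ExtAffWeyl n) (i : Node n) {x : ℤ}
    (hx : (x : ZMod n) = i.1) : descent ψ (sW i.next * w) i.1 =
      if position ψ w x < position ψ w (x + 2) then 1 else 0 := by
  have hx1 : ((x + 1 : ℤ) : ZMod n) = i.next.1 := by push_cast; rw [hx]; rfl
  rw [descent_eq ψ _ hx, position_sW_mul, position_sW_mul, affSwapFun_self hx1,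
    affSwapFun_other, add_assoc x 1 1, one_add_one_eq_two]
  · rw [hx]; exact i.ne_succ _
  · rw [hx]; exact ne_add_two hn i.1

/-- Both sides compare the positions of x and x + 2 for x ≡ i. -/
theorem descent_sW_mul_next_eq (hn : 3 ≤ n) (w : ExtAffWeyl n) (i : Node n) :
    descent ψ (sW i * w) i.next.1 = descent ψ (sW i.next * w) i.1 := by
  rw [descent_sW_mul_next ψ hn w i (residueLift_cast _),
    descent_sW_next_mul ψ hn w i (residueLift_cast _)]

/-- The possible values of the descents of `w`, for `x`, `x + 1` and `x + 2`. -/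
theorem descent_cases (hn : 3 ≤ n) (w : ExtAffWeyl n) (i : Node n) :
    (descent ψ w i.1 = 0 ∧ descent ψ w i.next.1 = 0 ∧ descent ψ (sW i * w) i.next.1 = 0) ∨
    (descent ψ w i.1 = 1 ∧ descent ψ w i.next.1 = 1 ∧ descent ψ (sW i * w) i.next.1 = 1) ∨
    ((descent ψ w i.1 = 0 ∧ descent ψ w i.next.1 = 1 ∨
      descent ψ w i.1 = 1 ∧ descent ψ w i.next.1 = 0) ∧
      (descent ψ (sW i * w) i.next.1 = 0 ∨ descent ψ (sW i * w) i.next.1 = 1)) := by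
  have hx := residueLift_cast i.1
  generalize residueLift i.1 = x at hx
  have hx1 : ((x + 1 : ℤ) : ZMod n) = i.next.1 := by push_cast; rw [hx]; rfl
  rw [descent_sW_mul_next ψ hn w i hx, descent_eq ψ w hx, descent_eq ψ w hx1, add_assoc x 1 1,
    one_add_one_eq_two]
  generalize position ψ w x = a
  generalize position ψ w (x + 1) = b
  generalize position ψ w (x + 2) = c
  by_cases h1 : a < b <;> by_cases h2 : b < c <;> by_cases h3 : a < c <;>
    simp only [h1, h2, h3, if_true, if_false] <;> simp
  · exact h3 (h1.trans h2)
  · exact absurd h3 (not_lt.mpr ((not_lt.mp h2).trans (not_lt.mp h1)))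

end Positions

/-! ### The operators of the generators and their relations. -/

section Operators

variable {r n : ℕ} (ψ : ZMod n → Fin r)

/-- The space of the representation induced from the colouring `ψ`. -/
abbrev InducedModule (r n : ℕ) : Type := ExtAffWeyl n →₀ GroundRing r

noncomputable instance : AddCommGroup (InducedModule r n) := Finsupp.instAddCommGroup

/-- The basis vector of `w`. -/
noncomputable def basisVec (r : ℕ) {n : ℕ} (w : ExtAffWeyl n) : InducedModule r n :=
  Finsupp.single w 1

/-- The linear map with given values on the basis vectors. -/
noncomputable def ofValues (f : ExtAffWeyl n → InducedModule r n) :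
    Module.End (GroundRing r) (InducedModule r n) :=
  Finsupp.linearCombination (GroundRing r) f

@[simp] theorem ofValues_basisVec (f : ExtAffWeyl n → InducedModule r n) (w : ExtAffWeyl n) :
    ofValues f (basisVec r w) = f w := by
  simp [ofValues, basisVec]

theorem end_ext {f g : Module.End (GroundRing r) (InducedModule r n)}
    (h : ∀ w, f (basisVec r w) = g (basisVec r w)) : f = g := by
  refine Finsupp.lhom_ext' fun w => LinearMap.ext_ring ?_
  exact h w

/-- The operator of `w_j`. -/
noncomputable def opW (j : ZMod n) : Module.End (GroundRing r) (InducedModule r n) :=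
  ofValues fun w => root r (colour ψ w j) • basisVec r w

/-- The operator of `h_{s_i}`. -/
noncomputable def opH (i : Node n) : Module.End (GroundRing r) (InducedModule r n) :=
  ofValues fun w => basisVec r (sW i * w) +
    ((descent ψ w i.1 : GroundRing r) * (q r - qInv r)) • basisVec r w

/-- The operator of left multiplication by an element of `Ŵ`. -/
noncomputable def opLeft (r : ℕ) {n : ℕ} (u : ExtAffWeyl n) :
    Module.End (GroundRing r) (InducedModule r n) :=
  ofValues fun w => basisVec r (u * w)

@[simp] theorem opW_basisVec (j : ZMod n) (w : ExtAffWeyl n) :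
    opW ψ j (basisVec r w) = root r (colour ψ w j) • basisVec r w := ofValues_basisVec _ _

@[simp] theorem opH_basisVec (i : Node n) (w : ExtAffWeyl n) :
    opH ψ i (basisVec r w) = basisVec r (sW i * w) +
      ((descent ψ w i.1 : GroundRing r) * (q r - qInv r)) • basisVec r w := ofValues_basisVec _ _

@[simp] theorem opLeft_basisVec (u w : ExtAffWeyl n) :
    opLeft r u (basisVec r w) = basisVec r (u * w) := ofValues_basisVec _ _

theorem opLeft_mul (u v : ExtAffWeyl n) : opLeft r u * opLeft r v = opLeft r (u * v) :=
  end_ext fun w => by simp [mul_assoc]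

theorem opLeft_one : opLeft r (1 : ExtAffWeyl n) = 1 := end_ext fun w => by simp

theorem opW_pow (hr : 1 ≤ r) (j : ZMod n) : opW ψ j ^ r = 1 := by
  refine end_ext fun w => ?_
  have h : ∀ k : ℕ, (opW ψ j ^ k) (basisVec r w) = root r (colour ψ w j) ^ k • basisVec r w := by
    intro k
    induction k with
    | zero => simp
    | succ k ih => rw [pow_succ', Module.End.mul_apply, ih, map_smul, opW_basisVec, smul_smul,
        pow_succ]
  rw [h, root_pow r hr]; simp

theorem opW_comm (i j : ZMod n) : opW ψ i * opW ψ j = opW ψ j * opW ψ i :=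
  end_ext fun w => by simp [smul_smul, mul_comm]

theorem opLeft_rhoW_mul_opW (j : ZMod n) :
    opLeft r (rhoW n) * opW ψ j = opW ψ (j - 1) * opLeft r (rhoW n) := by
  refine end_ext fun w => ?_
  have h : colour ψ (rhoW n * w) (j - 1) = colour ψ w j := by
    obtain ⟨x, rfl⟩ := ZMod.intCast_surjective j
    have := colour_eq_of_position_eq ψ (position_rhoW_mul ψ w (x - 1))
    simpa using this
  simp [h]

theorem opLeft_rhoW_mul_opH (i : Node n) :
    opLeft r (rhoW n) * opH ψ i = opH ψ i.prev * opLeft r (rhoW n) := by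
  refine end_ext fun w => ?_
  simp only [Module.End.mul_apply, opLeft_basisVec, opH_basisVec, map_add, map_smul,
    descent_rhoW_mul, ← mul_assoc, rhoW_mul_sW]

/-- On the span of e_w and e_{s_i w} the operator is the swap plus q - q⁻¹ at exactly one diagonal
place. -/
theorem opH_sq (i : Node n) : opH ψ i * opH ψ i = 1 + (q r - qInv r) • opH ψ i := by
  refine end_ext fun w => ?_
  have h := descent_sW_mul_self ψ w i
  simp only [Module.End.mul_apply, opH_basisVec, map_add, map_smul, sW_mul_sW_mul,
    LinearMap.add_apply, Module.End.one_apply, LinearMap.smul_apply]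
  generalize q r - qInv r = v
  rcases (show descent ψ w i.1 = 0 ∨ descent ψ w i.1 = 1 by omega) with h0 | h0
  · rw [h0] at h ⊢
    rw [show descent ψ (sW i * w) i.1 = 1 by omega]
    simp
  · rw [h0] at h ⊢
    rw [show descent ψ (sW i * w) i.1 = 0 by omega]
    simp

theorem opH_comm (i j : Node n) (h₁ : i.1 - j.1 ≠ 1) (h₂ : i.1 - j.1 ≠ -1) :
    opH ψ i * opH ψ j = opH ψ j * opH ψ i := by
  by_cases hij : i = j
  · rw [hij]
  refine end_ext fun w => ?_
  have e1 := descent_sW_mul_of_comm ψ w i j hij h₁ h₂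
  have e2 := descent_sW_mul_of_comm ψ w j i (Ne.symm hij)
    (fun e => h₂ (by linear_combination -e)) (fun e => h₁ (by linear_combination -e))
  simp only [Module.End.mul_apply, opH_basisVec, map_add, map_smul, e1, e2]
  rw [← mul_assoc, ← mul_assoc, sW_comm i j h₁ h₂]
  module

theorem opH_braid (hn : 3 ≤ n) (i : Node n) :
    opH ψ i * opH ψ i.next * opH ψ i = opH ψ i.next * opH ψ i * opH ψ i.next := by
  refine end_ext fun w => ?_
  have hb : sW i.next * (sW i * (sW i.next * w)) = sW i * (sW i.next * (sW i * w)) := by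
    simp only [← mul_assoc, sW_braid hn i]
  have a1 := descent_sW_mul_self ψ w i
  have b1 := descent_sW_mul_self ψ w i.next
  have m := descent_sW_mul_next_eq ψ hn w i
  have e1 := descent_sW_mul_next_eq ψ hn (sW i * w) i
  have e2 := descent_sW_mul_next_eq ψ hn (sW i.next * w) i
  -- Now every coefficient is a comparison among the positions of x, x + 1, x + 2 for w, or the
  -- complement of one. Transitivity leaves the cases of `descent_cases`.
  rw [sW_mul_sW_mul] at e1 e2
  simp only [Module.End.mul_apply, opH_basisVec, map_add, map_smul, sW_mul_sW_mul, hb, ← e1, e2,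
    ← m]
  generalize q r - qInv r = v
  rcases descent_cases ψ hn w i with ⟨ha, hc, hm⟩ | ⟨ha, hc, hm⟩ | ⟨⟨ha, hc⟩ | ⟨ha, hc⟩, hm | hm⟩
  all_goals
    rw [ha] at a1
    rw [hc] at b1
    simp only [ha, hc, hm]
    first
    | rw [show descent ψ (sW i * w) i.1 = 0 by omega]
    | rw [show descent ψ (sW i * w) i.1 = 1 by omega]
    first
    | rw [show descent ψ (sW i.next * w) i.next.1 = 0 by omega]
    | rw [show descent ψ (sW i.next * w) i.next.1 = 1 by omega]
    push_cast
    module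

theorem colour_sW_mul_self (w : ExtAffWeyl n) (i : Node n) :
    colour ψ (sW i * w) i.1 = colour ψ w (i.1 + 1) := by
  obtain ⟨x, hx⟩ := ZMod.intCast_surjective i.1
  have h := position_sW_mul ψ i w x
  rw [affSwapFun_self hx] at h
  have := colour_eq_of_position_eq ψ h
  push_cast at this
  rwa [hx] at this

theorem colour_sW_mul_next (w : ExtAffWeyl n) (i : Node n) :
    colour ψ (sW i * w) (i.1 + 1) = colour ψ w i.1 := by
  rw [← colour_sW_mul_self, sW_mul_sW_mul]

theorem colour_sW_mul_other (w : ExtAffWeyl n) (i : Node n) {l : ZMod n} (h₁ : l ≠ i.1)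
    (h₂ : l ≠ i.1 + 1) : colour ψ (sW i * w) l = colour ψ w l := by
  obtain ⟨x, rfl⟩ := ZMod.intCast_surjective l
  have h := position_sW_mul ψ i w x
  rw [affSwapFun_other h₁ h₂] at h
  exact colour_eq_of_position_eq ψ h

theorem descent_eq_one_of_colour_lt (w : ExtAffWeyl n) (i : ZMod n)
    (h : colour ψ w i < colour ψ w (i + 1)) : descent ψ w i = 1 := by
  rw [descent, if_pos]
  rw [Prod.Lex.lt_iff, position_fst, position_fst]
  left; simpa using h

theorem descent_eq_zero_of_colour_lt (w : ExtAffWeyl n) (i : ZMod n)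
    (h : colour ψ w (i + 1) < colour ψ w i) : descent ψ w i = 0 := by
  rw [descent, if_neg]
  refine lt_asymm ?_
  rw [Prod.Lex.lt_iff, position_fst, position_fst]
  left; simpa using h

/-- For equal colours the difference of roots vanishes, so the tie-breaking rule of the order plays
no role here. -/
theorem descent_mul_root_sub (w : ExtAffWeyl n) (i : ZMod n) :
    (descent ψ w i : GroundRing r) * (root r (colour ψ w (i + 1)) - root r (colour ψ w i)) =
      if colour ψ w i < colour ψ w (i + 1) then
        root r (colour ψ w (i + 1)) - root r (colour ψ w i) else 0 := by
  rcases lt_trichotomy (colour ψ w i) (colour ψ w (i + 1)) with h | h | h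
  · rw [if_pos h, descent_eq_one_of_colour_lt ψ w i h]; simp
  · rw [h]; simp
  · rw [if_neg h.asymm, descent_eq_zero_of_colour_lt ψ w i h]; simp

theorem crossTerm_opW_basisVec (hr : 1 ≤ r) (w : ExtAffWeyl n) (i : ZMod n) :
    crossTerm r (opW ψ i) (opW ψ (i + 1)) (basisVec r w) =
      ((descent ψ w i : GroundRing r) * (root r (colour ψ w (i + 1)) - root r (colour ψ w i)) *
        (q r - qInv r)) • basisVec r w := by
  rw [crossTerm_apply r hr (opW_basisVec ψ i w) (opW_basisVec ψ (i + 1) w), descent_mul_root_sub,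
    ite_mul, zero_mul]

theorem opH_mul_opW_self (hr : 1 ≤ r) (i : Node n) :
    opH ψ i * opW ψ i.1 =
      opW ψ (i.1 + 1) * opH ψ i - crossTerm r (opW ψ i.1) (opW ψ (i.1 + 1)) := by
  refine end_ext fun w => ?_
  rw [LinearMap.sub_apply, crossTerm_opW_basisVec ψ hr]
  simp only [Module.End.mul_apply, opH_basisVec, opW_basisVec, map_add, map_smul,
    colour_sW_mul_next]
  module

theorem opH_mul_opW_next (hr : 1 ≤ r) (i : Node n) :
    opH ψ i * opW ψ (i.1 + 1) =
      opW ψ i.1 * opH ψ i + crossTerm r (opW ψ i.1) (opW ψ (i.1 + 1)) := by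
  refine end_ext fun w => ?_
  rw [LinearMap.add_apply, crossTerm_opW_basisVec ψ hr]
  simp only [Module.End.mul_apply, opH_basisVec, opW_basisVec, map_add, map_smul,
    colour_sW_mul_self]
  module

theorem opH_mul_opW_other (i : Node n) {l : ZMod n} (h₁ : l ≠ i.1) (h₂ : l ≠ i.1 + 1) :
    opH ψ i * opW ψ l = opW ψ l * opH ψ i := by
  refine end_ext fun w => ?_
  simp only [Module.End.mul_apply, opH_basisVec, opW_basisVec, map_add, map_smul,
    colour_sW_mul_other ψ w i h₁ h₂]
  module

/-- The images of the generators in the induced representation. -/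
noncomputable def opGen : CGen n → Module.End (GroundRing r) (InducedModule r n)
  | .w j => opW ψ j
  | .h i => opH ψ i
  | .rho => opLeft r (rhoW n)
  | .rhoInv => opLeft r (rhoW n)⁻¹

theorem lift_opGen_crossTerm (i j : ZMod n) :
    FreeAlgebra.lift (GroundRing r) (opGen ψ) (crossTerm r (fw r i) (fw r j)) =
      crossTerm r (opW ψ i) (opW ψ j) := by
  refine (map_crossTerm r (A := FreeAlgebra (GroundRing r) (CGen n))
    (B := Module.End (GroundRing r) (InducedModule r n))
    (FreeAlgebra.lift (GroundRing r) (opGen ψ)) _ _).trans ?_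
  rw [fw, fw, FreeAlgebra.lift_ι_apply, FreeAlgebra.lift_ι_apply]
  rfl

theorem lift_opGen_rel (hr : 1 ≤ r) {x y : FreeAlgebra (GroundRing r) (CGen n)}
    (h : CRel r n x y) : FreeAlgebra.lift (GroundRing r) (opGen ψ) x =
      FreeAlgebra.lift (GroundRing r) (opGen ψ) y := by
  induction h with
  | w_pow j => simpa [fw, opGen] using opW_pow ψ hr j
  | w_comm i j => simpa [fw, opGen] using opW_comm ψ i j
  | rho_w j => simpa [fw, frho, opGen] using opLeft_rhoW_mul_opW ψ j
  | rho_h i => simpa [fh, frho, opGen] using opLeft_rhoW_mul_opH ψ i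
  | h_comm i j h₁ h₂ => simpa [fh, opGen] using opH_comm ψ i j h₁ h₂
  | h_braid hn i => simpa [fh, opGen] using opH_braid ψ hn i
  | h_sq i =>
    simp only [map_mul, map_add, map_one, map_smul, fh, FreeAlgebra.lift_ι_apply, opGen]
    exact opH_sq ψ i
  | h_w_self i hi =>
    simp only [map_mul, map_sub, lift_opGen_crossTerm]
    simp only [fh, fw, FreeAlgebra.lift_ι_apply, opGen]
    exact opH_mul_opW_self ψ hr i
  | h_w_next i hi =>
    simp only [map_mul, map_add, lift_opGen_crossTerm]
    simp only [fh, fw, FreeAlgebra.lift_ι_apply, opGen]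
    exact opH_mul_opW_next ψ hr i
  | h_w_other i hi l h₁ h₂ => simpa [fh, fw, opGen] using opH_mul_opW_other ψ i h₁ h₂
  | rho_mul_inv => simp [frho, frhoInv, opGen, opLeft_mul, opLeft_one]
  | inv_mul_rho => simp [frho, frhoInv, opGen, opLeft_mul, opLeft_one]

/-- The representation of `Ĉ^aff_{r,n}` induced from the colouring `ψ`. -/
noncomputable def inducedRep (hr : 1 ≤ r) :
    CAff r n →ₐ[GroundRing r] Module.End (GroundRing r) (InducedModule r n) :=
  RingQuot.liftAlgHom (GroundRing r) ⟨FreeAlgebra.lift (GroundRing r) (opGen ψ),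
    fun _ _ h => lift_opGen_rel ψ hr h⟩

theorem inducedRep_wC (hr : 1 ≤ r) (j : ZMod n) : inducedRep ψ hr (wC r j) = opW ψ j := by
  simp [inducedRep, wC, fw, opGen]

theorem inducedRep_hC (hr : 1 ≤ r) (i : Node n) : inducedRep ψ hr (hC r i) = opH ψ i := by
  simp [inducedRep, hC, fh, opGen]

theorem inducedRep_hRho (hr : 1 ≤ r) :
    inducedRep ψ hr (hRho r n : CAff r n) = opLeft r (rhoW n) := by
  simp [inducedRep, hRho, frho, opGen]

end Operators

/-! ## Linear independence -/

section Independence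

variable {r n : ℕ} (ψ : ZMod n → Fin r) (hr : 1 ≤ r)

/-- Left multiplication by `Ŵ` as a homomorphism. -/
noncomputable def opLeftHom (r n : ℕ) :
    ExtAffWeyl n →* Module.End (GroundRing r) (InducedModule r n) where
  toFun := opLeft r
  map_one' := opLeft_one
  map_mul' u v := (opLeft_mul u v).symm

theorem inducedRep_hRho_zpow (k : ℤ) :
    inducedRep ψ hr ((hRho r n ^ k : (CAff r n)ˣ) : CAff r n) = opLeft r (rhoW n ^ k) := by
  have h : Units.map (inducedRep ψ hr : CAff r n →* _) (hRho r n) =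
      (opLeftHom r n).toHomUnits (rhoW n) := Units.ext (inducedRep_hRho ψ hr)
  have h' := congrArg (fun u => ((u ^ k : _ˣ) : Module.End (GroundRing r) (InducedModule r n))) h
  simp only [← map_zpow] at h'
  exact h'

theorem inducedRep_hExpr (k : ℤ) (L : List (Node n)) :
    inducedRep ψ hr (hExpr r k L) = opLeft r (rhoW n ^ k) * (L.map (opH ψ)).prod := by
  rw [hExpr, map_mul, inducedRep_hRho_zpow, map_list_prod, List.map_map]
  congr 3
  funext i
  exact inducedRep_hC ψ hr i

/-- The span of the basis vectors of products of fewer than `m` simple reflections. -/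
noncomputable def lowerPart (r n m : ℕ) : Submodule (GroundRing r) (InducedModule r n) :=
  Submodule.span (GroundRing r)
    (basisVec r '' {u | ∃ L : List (Node n), L.length < m ∧ u = (L.map sW).prod})

theorem basisVec_mem_lowerPart {m : ℕ} {L : List (Node n)} (h : L.length < m) :
    basisVec r (L.map sW).prod ∈ lowerPart r n m :=
  Submodule.subset_span ⟨_, ⟨L, h, rfl⟩, rfl⟩

theorem opH_mem_lowerPart (i : Node n) {m : ℕ} {x : InducedModule r n}
    (hx : x ∈ lowerPart r n m) : opH ψ i x ∈ lowerPart r n (m + 1) := by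
  rw [lowerPart] at hx
  induction hx using Submodule.span_induction with
  | mem x hx =>
    obtain ⟨_, ⟨L, hL, rfl⟩, rfl⟩ := hx
    rw [opH_basisVec]
    refine add_mem ?_ (Submodule.smul_mem _ _ (basisVec_mem_lowerPart (by omega)))
    have := basisVec_mem_lowerPart (r := r) (m := m + 1) (L := i :: L) (by simpa using hL)
    simpa using this
  | zero => rw [map_zero]; exact zero_mem _
  | add x y _ _ hx hy => rw [map_add]; exact add_mem hx hy
  | smul a x _ hx => rw [map_smul]; exact Submodule.smul_mem _ _ hx

/-- Each factor contributes its leading term s_i w plus a multiple of w, so every other term is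
spelt by fewer letters. -/
theorem prod_opH_sub_mem_lowerPart (L : List (Node n)) :
    (L.map (opH ψ)).prod (basisVec r 1) - basisVec r (L.map sW).prod ∈
      lowerPart r n L.length := by
  induction L with
  | nil => simp
  | cons i L ih =>
    have h := opH_mem_lowerPart ψ i ih
    rw [map_sub, opH_basisVec] at h
    have h' := add_mem h (Submodule.smul_mem _
      ((descent ψ (L.map sW).prod i.1 : GroundRing r) * (q r - qInv r))
      (basisVec_mem_lowerPart (r := r) (Nat.lt_succ_self L.length)))
    simp only [List.map_cons, List.prod_cons, Module.End.mul_apply, List.length_cons]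
    convert h' using 1
    abel

/-- The length of the chosen reduced expression of an element of `Ŵ`. -/
noncomputable def weylLength (w : ExtAffWeyl n) : ℕ :=
  (exists_reducedExpression w).choose.2.length

-- Triangularity: a lower term ρ^k u equal to w₀ would represent the reflection part of w₀ by a word
-- shorter than its reduced word.
open Classical in
theorem inducedRep_hElt_apply {w w₀ : ExtAffWeyl n} (h : weylLength w ≤ weylLength w₀) :
    (inducedRep ψ hr (hElt r w) (basisVec r 1) : ExtAffWeyl n →₀ GroundRing r) w₀ =
      if w = w₀ then 1 else 0 := by
  rw [weylLength, weylLength] at h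
  have hw := (exists_reducedExpression w).choose_spec
  have hw₀ := (exists_reducedExpression w₀).choose_spec
  rw [hElt]
  generalize (exists_reducedExpression w).choose = e at *
  generalize (exists_reducedExpression w₀).choose = e₀ at *
  obtain ⟨k, L⟩ := e
  obtain ⟨k₀, L₀⟩ := e₀
  dsimp only at *
  have hL := prod_opH_sub_mem_lowerPart ψ L
  have hlow : ∀ x ∈ lowerPart r n L.length,
      (opLeft r (rhoW n ^ k) x : ExtAffWeyl n →₀ GroundRing r) w₀ = 0 := by
    intro x hx
    rw [lowerPart] at hx
    induction hx using Submodule.span_induction with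
    | mem x hx =>
      obtain ⟨_, ⟨L', hL', rfl⟩, rfl⟩ := hx
      rw [opLeft_basisVec, basisVec, Finsupp.single_eq_of_ne]
      intro he
      have := hw₀.2 L' (expression_injective (he.symm.trans hw₀.1)).2
      omega
    | zero => rw [map_zero]; rfl
    | add x y _ _ hx hy => rw [map_add]; exact (congrArg₂ (· + ·) hx hy).trans (add_zero _)
    | smul a x _ hx => rw [map_smul]; exact (congrArg (a * ·) hx).trans (mul_zero _)
  have h0 := hlow _ hL
  rw [map_sub, opLeft_basisVec, ← hw.1] at h0
  rw [inducedRep_hExpr, Module.End.mul_apply]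
  have h1 := sub_eq_zero.mp ((Finsupp.sub_apply _ _ _).symm.trans h0)
  rw [h1, basisVec, Finsupp.single_apply]

/-! ### The diagonal action of the w_j and the conclusion. -/

theorem opW_apply (j : ZMod n) (m : InducedModule r n) (w : ExtAffWeyl n) :
    (opW ψ j m : ExtAffWeyl n →₀ GroundRing r) w = root r (colour ψ w j) * m w := by
  have h : (Finsupp.lapply w : (ExtAffWeyl n →₀ GroundRing r) →ₗ[GroundRing r] GroundRing r) ∘ₗ
      opW ψ j = root r (colour ψ w j) • Finsupp.lapply w := by
    refine Finsupp.lhom_ext' fun u => LinearMap.ext_ring ?_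
    change (opW ψ j (basisVec r u) : ExtAffWeyl n →₀ GroundRing r) w =
      root r (colour ψ w j) * basisVec r u w
    rw [opW_basisVec, Finsupp.smul_apply, smul_eq_mul]
    by_cases hu : u = w
    · rw [hu]
    · rw [basisVec, Finsupp.single_eq_of_ne (Ne.symm hu), mul_zero, mul_zero]
  exact LinearMap.congr_fun h m

theorem opW_pow_apply (j : ZMod n) (k : ℕ) (m : InducedModule r n) (w : ExtAffWeyl n) :
    ((opW ψ j ^ k) m : ExtAffWeyl n →₀ GroundRing r) w = root r (colour ψ w j) ^ k * m w := by
  induction k with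
  | zero => simp
  | succ k ih => rw [pow_succ', Module.End.mul_apply, opW_apply, ih, pow_succ', mul_assoc]

theorem prod_ofFn_apply {N : ℕ} (w : ExtAffWeyl n)
    (f : Fin N → Module.End (GroundRing r) (InducedModule r n)) (c : Fin N → GroundRing r)
    (h : ∀ (j : Fin N) (m : InducedModule r n),
      (f j m : ExtAffWeyl n →₀ GroundRing r) w = c j * m w) (m : InducedModule r n) :
    ((List.ofFn f).prod m : ExtAffWeyl n →₀ GroundRing r) w = (∏ j, c j) * m w := by
  induction N with
  | zero => simp
  | succ N ih =>
    rw [List.ofFn_succ, List.prod_cons, Module.End.mul_apply, h, ih _ (fun j => c j.succ)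
      (fun j => h j.succ), Fin.prod_univ_succ, mul_assoc]

theorem inducedRep_wMonomial_apply (α : Fin n → Fin r) (m : InducedModule r n)
    (w : ExtAffWeyl n) :
    (inducedRep ψ hr (wMonomial r α) m : ExtAffWeyl n →₀ GroundRing r) w =
      (∏ j : Fin n, root r (colour ψ w (((j : ℕ) + 1 : ℕ) : ZMod n)) ^ (α j : ℕ)) * m w := by
  rw [wMonomial, map_list_prod, List.map_ofFn]
  refine prod_ofFn_apply w _ _ (fun j m => ?_) m
  simp only [Function.comp_apply, map_pow, inducedRep_wC]
  exact opW_pow_apply ψ _ _ _ _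

theorem natCast_succ_bijective (hn : 1 ≤ n) :
    Function.Bijective fun j : Fin n => (((j : ℕ) + 1 : ℕ) : ZMod n) := by
  have : NeZero n := ⟨by omega⟩
  rw [Fintype.bijective_iff_injective_and_card]
  refine ⟨fun i j h => ?_, by simp⟩
  simp only [Nat.cast_add, Nat.cast_one, add_left_inj] at h
  rw [ZMod.natCast_eq_natCast_iff'] at h
  rw [Nat.mod_eq_of_lt i.2, Nat.mod_eq_of_lt j.2] at h
  exact Fin.ext h

theorem exists_colour_eq (hn : 1 ≤ n) (w : ExtAffWeyl n) (χ : Fin n → Fin r) :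
    ∃ ψ : ZMod n → Fin r, ∀ j : Fin n, colour ψ w (((j : ℕ) + 1 : ℕ) : ZMod n) = χ j := by
  -- As the colour at j is ψ (w⁻¹ j), the colouring must be χ composed with w.
  refine ⟨fun k => χ ((Equiv.ofBijective _ (natCast_succ_bijective hn)).symm (residueAct w k)),
    fun j => ?_⟩
  have h := residueAct_inv_residueAct w⁻¹ (((j : ℕ) + 1 : ℕ) : ZMod n)
  rw [inv_inv] at h
  rw [colour, h]
  congr 1
  exact Equiv.ofBijective_symm_apply_apply _ (natCast_succ_bijective hn) j

theorem linearIndependent_wMonomial_mul_hElt (hn : 1 ≤ n) (hr : 1 ≤ r) :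
    LinearIndependent (GroundRing r)
      fun p : (Fin n → Fin r) × ExtAffWeyl n => wMonomial r p.1 * hElt r p.2 := by
  classical
  refine (injective_iff_map_eq_zero (Finsupp.linearCombination (GroundRing r) _)).mpr
    fun l hl => ?_
  by_contra hne
  obtain ⟨⟨α₀, w₀⟩, hp, hmax⟩ := Finset.exists_max_image l.support (fun p => weylLength p.2)
    (Finsupp.support_nonempty_iff.mpr hne)
  refine Finsupp.mem_support_iff.mp hp ?_
  refine eq_zero_of_sum_root_pow_eq_zero r hr (fun α => l (α, w₀)) (fun χ => ?_) α₀
  obtain ⟨ψ, hψ⟩ := exists_colour_eq hn w₀ χ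
  have h1 : (inducedRep ψ hr (Finsupp.linearCombination (GroundRing r)
      (fun p : (Fin n → Fin r) × ExtAffWeyl n => wMonomial r p.1 * hElt r p.2) l)
      (basisVec r 1) : ExtAffWeyl n →₀ GroundRing r) w₀ = 0 := by
    rw [hl, map_zero]; rfl
  rw [Finsupp.linearCombination_apply, Finsupp.sum, map_sum, LinearMap.sum_apply,
    Finsupp.finsetSum_apply] at h1
  have h2 : ∀ p ∈ l.support, (inducedRep ψ hr (l p • (wMonomial r p.1 * hElt r p.2))
      (basisVec r 1) : ExtAffWeyl n →₀ GroundRing r) w₀ =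
      if p.2 = w₀ then l p * ∏ j, root r (χ j) ^ (p.1 j : ℕ) else 0 := by
    intro p hp
    rw [map_smul, LinearMap.smul_apply, Finsupp.smul_apply, map_mul, Module.End.mul_apply,
      inducedRep_wMonomial_apply, inducedRep_hElt_apply ψ hr (hmax p hp), smul_eq_mul]
    simp only [hψ]
    by_cases h : p.2 = w₀
    · rw [if_pos h, if_pos h, mul_one]
    · rw [if_neg h, if_neg h, mul_zero, mul_zero]
  rw [Finset.sum_congr rfl h2, ← Finset.sum_filter] at h1
  rw [← h1]
  symm
  -- The surviving pairs (α, w₀) are reindexed by α; exponents outside the support contribute zero.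
  refine Finset.sum_of_injOn (fun p => p.1) ?_ (fun _ _ => Finset.mem_univ _) ?_ ?_
  · rintro ⟨α, w⟩ h ⟨α', w'⟩ h' e
    simp only [Finset.coe_filter, Set.mem_ofPred_eq] at h h' e
    rw [h.2, h'.2, e]
  · intro α _ hα
    have : l (α, w₀) = 0 := by
      by_contra h0
      exact hα ⟨(α, w₀), by simpa using h0, rfl⟩
    rw [this, zero_mul]
  · rintro ⟨α, w⟩ h
    simp only [Finset.mem_filter] at h
    rw [← h.2]

end Independence

/-! ## Spanning -/

section Spanning

variable {r n : ℕ}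

noncomputable instance : Ring (CAff r n) := Algebra.semiringToRing (GroundRing r)

theorem hC_mul_self (i : Node n) : hC r i * hC r i = 1 + (q r - qInv r) • hC r i := by
  have h := RingQuot.mkAlgHom_rel (GroundRing r) (CRel.h_sq (r := r) i)
  simp only [map_mul, map_add, map_one, map_smul] at h
  exact h

theorem hRho_mul_hC (i : Node n) :
    (hRho r n : CAff r n) * hC r i = hC r i.prev * (hRho r n : CAff r n) := by
  have h := RingQuot.mkAlgHom_rel (GroundRing r) (CRel.rho_h (r := r) i)
  simp only [map_mul] at h
  exact h

theorem hRho_mul_wC (j : ZMod n) :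
    (hRho r n : CAff r n) * wC r j = wC r (j - 1) * (hRho r n : CAff r n) := by
  have h := RingQuot.mkAlgHom_rel (GroundRing r) (CRel.rho_w (r := r) j)
  simp only [map_mul] at h
  exact h

theorem wC_pow (j : ZMod n) : wC r j ^ r = 1 := by
  have h := RingQuot.mkAlgHom_rel (GroundRing r) (CRel.w_pow (r := r) j)
  simp only [map_pow, map_one] at h
  exact h

theorem wC_comm (i j : ZMod n) : wC r i * wC r j = wC r j * wC r i := by
  have h := RingQuot.mkAlgHom_rel (GroundRing r) (CRel.w_comm (r := r) i j)
  simp only [map_mul] at h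
  exact h

theorem hC_comm (i j : Node n) (h₁ : i.1 - j.1 ≠ 1) (h₂ : i.1 - j.1 ≠ -1) :
    hC r i * hC r j = hC r j * hC r i := by
  have h := RingQuot.mkAlgHom_rel (GroundRing r) (CRel.h_comm (r := r) i j h₁ h₂)
  simp only [map_mul] at h
  exact h

theorem hC_braid (hn : 3 ≤ n) (i : Node n) :
    hC r i * hC r i.next * hC r i = hC r i.next * hC r i * hC r i.next := by
  have h := RingQuot.mkAlgHom_rel (GroundRing r) (CRel.h_braid (r := r) hn i)
  simp only [map_mul] at h
  exact h

theorem hC_mul_wC_self (i : Node n) (hi : i.1 ≠ 0) :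
    hC r i * wC r i.1 = wC r (i.1 + 1) * hC r i - RingQuot.mkAlgHom (GroundRing r) (CRel r n)
      (crossTerm r (fw r i.1) (fw r (i.1 + 1))) := by
  have h := RingQuot.mkAlgHom_rel (GroundRing r) (CRel.h_w_self (r := r) i hi)
  simp only [map_mul, map_sub] at h
  exact h

theorem hC_mul_wC_next (i : Node n) (hi : i.1 ≠ 0) :
    hC r i * wC r (i.1 + 1) = wC r i.1 * hC r i + RingQuot.mkAlgHom (GroundRing r) (CRel r n)
      (crossTerm r (fw r i.1) (fw r (i.1 + 1))) := by
  have h := RingQuot.mkAlgHom_rel (GroundRing r) (CRel.h_w_next (r := r) i hi)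
  simp only [map_mul, map_add] at h
  exact h

theorem hC_mul_wC_other (i : Node n) (hi : i.1 ≠ 0) (l : ZMod n) (h₁ : l ≠ i.1)
    (h₂ : l ≠ i.1 + 1) : hC r i * wC r l = wC r l * hC r i := by
  have h := RingQuot.mkAlgHom_rel (GroundRing r) (CRel.h_w_other (r := r) i hi l h₁ h₂)
  simp only [map_mul] at h
  exact h

/-- `h_ŵ` does not depend on the reduced expression. -/
theorem hElt_eq_hExpr {w : ExtAffWeyl n} {k : ℤ} {L : List (Node n)}
    (h : IsReducedExpression w k L) : hElt r w = hExpr r k L := by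
  have h' := (exists_reducedExpression w).choose_spec
  obtain ⟨hk, hL⟩ := expression_injective (h'.1.symm.trans h.1)
  rw [hElt, hExpr, hExpr, hk, IsReducedWord.prod_eq (hC r) hC_comm hC_braid h'.2 h.2 hL]

variable (r n) in
/-- The span of the elements `h_ŵ`. -/
noncomputable def hSpan : Submodule (GroundRing r) (CAff r n) :=
  Submodule.span (GroundRing r) (Set.range (hElt r))

theorem hExpr_mem_of_isReducedWord (k : ℤ) {L : List (Node n)} (h : IsReducedWord L) :
    hExpr r k L ∈ hSpan r n := by
  rw [← hElt_eq_hExpr (w := rhoW n ^ k * (L.map sW).prod) ⟨rfl, h⟩]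
  exact Submodule.subset_span ⟨_, rfl⟩

theorem hExpr_append (k : ℤ) (L : List (Node n)) (i : Node n) :
    hExpr r k (L ++ [i]) = hExpr r k L * hC r i := by
  simp [hExpr, mul_assoc]

/-- If `L ++ [i]` is not reduced, exchange rewrites L as a reduced word ending in i, Matsumoto's
theorem transfers this to the h's, and the quadratic relation applies. -/
theorem hExpr_mul_hC_mem (k : ℤ) {L : List (Node n)} (h : IsReducedWord L) (i : Node n) :
    hExpr r k L * hC r i ∈ hSpan r n := by
  rcases h.append_or_exchange i with h' | ⟨L₁, j, L₂, rfl, e⟩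
  · rw [← hExpr_append]
    exact hExpr_mem_of_isReducedWord k h'
  · have e' : ((L₁ ++ L₂ ++ [i]).map sW).prod = ((L₁ ++ j :: L₂).map sW).prod := by
      rw [List.map_append, List.prod_append, ← e]; simp [mul_assoc, sW_mul_self]
    have hred : IsReducedWord (L₁ ++ L₂ ++ [i]) := h.of_length_le e' (by simp)
    have e2 : hExpr r k (L₁ ++ j :: L₂) = hExpr r k (L₁ ++ L₂) * hC r i := by
      rw [← hExpr_append, hExpr, hExpr,
        IsReducedWord.prod_eq (hC r) hC_comm hC_braid h hred e'.symm]
    have e3 : hExpr r k (L₁ ++ L₂) * ((q r - qInv r) • hC r i) =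
        (q r - qInv r) • (hExpr r k (L₁ ++ L₂) * hC r i) :=
      Algebra.mul_smul_comm (R := GroundRing r) (A := CAff r n) (q r - qInv r) _ (hC r i)
    rw [e2, mul_assoc, hC_mul_self, mul_add, mul_one, e3, ← e2]
    exact add_mem (hExpr_mem_of_isReducedWord k hred.of_append_left)
      (Submodule.smul_mem _ _ (hExpr_mem_of_isReducedWord k h))

theorem mul_hC_mem_hSpan {x : CAff r n} (hx : x ∈ hSpan r n) (i : Node n) :
    x * hC r i ∈ hSpan r n := by
  rw [hSpan] at hx
  induction hx using Submodule.span_induction with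
  | mem x hx =>
    obtain ⟨w, rfl⟩ := hx
    exact hExpr_mul_hC_mem _ (exists_reducedExpression w).choose_spec.2 i
  | zero => rw [zero_mul]; exact zero_mem _
  | add x y _ _ hx hy => rw [add_mul]; exact add_mem hx hy
  | smul a x _ hx => rw [smul_mul_assoc]; exact Submodule.smul_mem _ _ hx

theorem hExpr_mem_hSpan (k : ℤ) (L : List (Node n)) : hExpr r k L ∈ hSpan r n := by
  induction L using List.reverseRecOn with
  | nil => exact hExpr_mem_of_isReducedWord k isReducedWord_nil
  | append_singleton L i ih => rw [hExpr_append]; exact mul_hC_mem_hSpan ih i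

theorem hC_mul_hRho (i : Node n) :
    hC r i * (hRho r n : CAff r n) = (hRho r n : CAff r n) * hC r i.next := by
  rw [hRho_mul_hC]; simp [Node.next, Node.prev]

theorem exists_hC_mul_zpow (k : ℤ) (i : Node n) :
    ∃ j : Node n, hC r i * ((hRho r n ^ k : (CAff r n)ˣ) : CAff r n) =
      ((hRho r n ^ k : (CAff r n)ˣ) : CAff r n) * hC r j := by
  induction k with
  | zero => exact ⟨i, by simp⟩
  | succ k ih =>
    obtain ⟨j, hj⟩ := ih
    refine ⟨j.next, ?_⟩
    rw [zpow_add_one, Units.val_mul, ← mul_assoc, hj, mul_assoc, hC_mul_hRho, mul_assoc]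
  | pred k ih =>
    obtain ⟨j, hj⟩ := ih
    refine ⟨j.prev, ?_⟩
    rw [zpow_sub_one, Units.val_mul, ← mul_assoc, hj, mul_assoc, mul_assoc]
    congr 1
    rw [Units.mul_inv_eq_iff_eq_mul, mul_assoc, ← hRho_mul_hC, Units.inv_mul_cancel_left]

/-- It suffices to test on products over arbitrary words, which stay in the span by
`hExpr_mem_hSpan`; left multiplications then need no reducedness. -/
theorem left_mul_mem_hSpan {a : CAff r n}
    (ha : ∀ k L, a * hExpr r k L ∈ hSpan r n) {x : CAff r n} (hx : x ∈ hSpan r n) :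
    a * x ∈ hSpan r n := by
  rw [hSpan] at hx
  induction hx using Submodule.span_induction with
  | mem x hx =>
    obtain ⟨w, rfl⟩ := hx
    exact ha _ _
  | zero => rw [mul_zero]; exact zero_mem _
  | add x y _ _ hx hy => rw [mul_add]; exact add_mem hx hy
  | smul b x _ hx => rw [mul_smul_comm]; exact Submodule.smul_mem _ _ hx

theorem hC_mul_mem_hSpan (i : Node n) {x : CAff r n} (hx : x ∈ hSpan r n) :
    hC r i * x ∈ hSpan r n := by
  refine left_mul_mem_hSpan (fun k L => ?_) hx
  obtain ⟨j, hj⟩ := exists_hC_mul_zpow (r := r) k i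
  have : hC r i * hExpr r k L = hExpr r k (j :: L) := by
    rw [hExpr, ← mul_assoc, hj, hExpr, List.map_cons, List.prod_cons, mul_assoc]
  rw [this]
  exact hExpr_mem_hSpan _ _

theorem hRho_zpow_mul_mem_hSpan (m : ℤ) {x : CAff r n} (hx : x ∈ hSpan r n) :
    ((hRho r n ^ m : (CAff r n)ˣ) : CAff r n) * x ∈ hSpan r n := by
  refine left_mul_mem_hSpan (fun k L => ?_) hx
  rw [hExpr, ← mul_assoc, ← Units.val_mul, ← zpow_add]
  exact hExpr_mem_hSpan (m + k) L

/-! ### Moving the w_j to the left. -/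

variable (r n) in
/-- The subalgebra generated by the elements `w_j`. -/
noncomputable def wAlg : Subalgebra (GroundRing r) (CAff r n) :=
  Algebra.adjoin (GroundRing r) (Set.range (wC r))

theorem wC_mem (j : ZMod n) : wC r j ∈ wAlg r n := Algebra.subset_adjoin ⟨j, rfl⟩

theorem aeval_mem_of_mem {R A : Type*} [CommSemiring R] [Semiring A] [Algebra R A]
    {S : Subalgebra R A} {x : A} (hx : x ∈ S) (p : R[X]) : Polynomial.aeval x p ∈ S := by
  rw [Polynomial.aeval_eq_sum_range]
  exact sum_mem fun i _ => Subalgebra.smul_mem _ (pow_mem hx i) _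

theorem crossTerm_mem (i j : ZMod n) : RingQuot.mkAlgHom (GroundRing r) (CRel r n)
    (crossTerm r (fw r i) (fw r j)) ∈ wAlg r n := by
  have hc : RingQuot.mkAlgHom (GroundRing r) (CRel r n) (crossTerm r (fw r i) (fw r j)) =
      crossTerm r (wC r i) (wC r j) :=
    map_crossTerm r (A := FreeAlgebra (GroundRing r) (CGen n)) (B := CAff r n)
      (RingQuot.mkAlgHom (GroundRing r) (CRel r n)) _ _
  rw [hc, crossTerm]
  exact Subalgebra.smul_mem _ (sum_mem fun c _ => Subalgebra.smul_mem _
    (mul_mem (aeval_mem_of_mem (wC_mem i) _) (aeval_mem_of_mem (wC_mem j) _)) _) _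

theorem exists_mul_eq_of_mem_wAlg {x : CAff r n}
    (hx : ∀ j, ∃ t ∈ wAlg r n, x * wC r j = t * x) {a : CAff r n} (ha : a ∈ wAlg r n) :
    ∃ t ∈ wAlg r n, x * a = t * x := by
  induction ha using Algebra.adjoin_induction with
  | mem a ha => obtain ⟨j, rfl⟩ := ha; exact hx j
  | algebraMap c => exact ⟨_, Subalgebra.algebraMap_mem _ c, (Algebra.commutes c x).symm⟩
  | add a b _ _ iha ihb =>
    obtain ⟨t, ht, e⟩ := iha
    obtain ⟨t', ht', e'⟩ := ihb
    exact ⟨t + t', add_mem ht ht', by rw [mul_add, e, e', add_mul]⟩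
  | mul a b _ _ iha ihb =>
    obtain ⟨t, ht, e⟩ := iha
    obtain ⟨t', ht', e'⟩ := ihb
    exact ⟨t * t', mul_mem ht ht', by rw [← mul_assoc, e, mul_assoc, e', mul_assoc]⟩

/-- The property passes to products: x a = t x + u and x b = t' x + u' give x a b = t t' x + (t u' +
u b). -/
theorem exists_mul_eq_add_of_mem_wAlg {x : CAff r n}
    (hx : ∀ j, ∃ t ∈ wAlg r n, ∃ u ∈ wAlg r n, x * wC r j = t * x + u) {a : CAff r n}
    (ha : a ∈ wAlg r n) : ∃ t ∈ wAlg r n, ∃ u ∈ wAlg r n, x * a = t * x + u := by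
  induction ha using Algebra.adjoin_induction with
  | mem a ha => obtain ⟨j, rfl⟩ := ha; exact hx j
  | algebraMap c =>
    exact ⟨_, Subalgebra.algebraMap_mem _ c, 0, zero_mem _,
      (Algebra.commutes c x).symm.trans (add_zero _).symm⟩
  | add a b _ _ iha ihb =>
    obtain ⟨t, ht, u, hu, e⟩ := iha
    obtain ⟨t', ht', u', hu', e'⟩ := ihb
    exact ⟨t + t', add_mem ht ht', u + u', add_mem hu hu', by
      rw [mul_add, e, e', add_mul]; abel⟩
  | mul a b _ hb iha ihb =>
    obtain ⟨t, ht, u, hu, e⟩ := iha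
    obtain ⟨t', ht', u', hu', e'⟩ := ihb
    exact ⟨t * t', mul_mem ht ht', t * u' + u * b, add_mem (mul_mem ht hu') (mul_mem hu hb), by
      rw [← mul_assoc, e, add_mul, mul_assoc, e', mul_add, mul_assoc, add_assoc]⟩

theorem exists_hRho_mul {a : CAff r n} (ha : a ∈ wAlg r n) :
    ∃ t ∈ wAlg r n, (hRho r n : CAff r n) * a = t * (hRho r n : CAff r n) :=
  exists_mul_eq_of_mem_wAlg (fun j => ⟨_, wC_mem _, hRho_mul_wC j⟩) ha

theorem hRho_inv_mul_wC (j : ZMod n) :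
    (((hRho r n)⁻¹ : (CAff r n)ˣ) : CAff r n) * wC r j =
      wC r (j + 1) * (((hRho r n)⁻¹ : (CAff r n)ˣ) : CAff r n) := by
  rw [Units.inv_mul_eq_iff_eq_mul, ← mul_assoc, hRho_mul_wC, add_sub_cancel_right,
    Units.mul_inv_cancel_right]

theorem exists_hRho_inv_mul {a : CAff r n} (ha : a ∈ wAlg r n) :
    ∃ t ∈ wAlg r n, (((hRho r n)⁻¹ : (CAff r n)ˣ) : CAff r n) * a =
      t * (((hRho r n)⁻¹ : (CAff r n)ˣ) : CAff r n) :=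
  exists_mul_eq_of_mem_wAlg (fun j => ⟨_, wC_mem _, hRho_inv_mul_wC j⟩) ha

theorem exists_hC_mul_wC_of_ne_zero (i : Node n) (hi : i.1 ≠ 0) (j : ZMod n) :
    ∃ t ∈ wAlg r n, ∃ u ∈ wAlg r n, hC r i * wC r j = t * hC r i + u := by
  by_cases h1 : j = i.1
  · subst h1
    exact ⟨_, wC_mem _, _, neg_mem (crossTerm_mem i.1 (i.1 + 1)), by
      rw [hC_mul_wC_self i hi, sub_eq_add_neg]⟩
  by_cases h2 : j = i.1 + 1
  · subst h2
    exact ⟨_, wC_mem _, _, crossTerm_mem i.1 (i.1 + 1), hC_mul_wC_next i hi⟩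
  · exact ⟨_, wC_mem _, 0, zero_mem _, by rw [add_zero, hC_mul_wC_other i hi j h1 h2]⟩

theorem exists_hC_mul_wC (i : Node n) (j : ZMod n) :
    ∃ t ∈ wAlg r n, ∃ u ∈ wAlg r n, hC r i * wC r j = t * hC r i + u := by
  by_cases hi : i.1 = 0
  -- No mixed relation is imposed at label 0, so the one at label 1 is conjugated by h_ρ.
  · have hne : i.next.1 ≠ 0 := by
      change i.1 + 1 ≠ 0
      rw [hi]; exact (i.ne_succ 0).symm
    have hh : hC r i = (hRho r n : CAff r n) * hC r i.next *
        (((hRho r n)⁻¹ : (CAff r n)ˣ) : CAff r n) := by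
      rw [← hC_mul_hRho, Units.mul_inv_cancel_right]
    obtain ⟨t, ht, u, hu, e⟩ := exists_hC_mul_wC_of_ne_zero (r := r) i.next hne (j + 1)
    obtain ⟨t', ht', e'⟩ := exists_hRho_mul ht
    obtain ⟨u', hu', f'⟩ := exists_hRho_mul hu
    refine ⟨t', ht', u', hu', ?_⟩
    calc hC r i * wC r j
        = (hRho r n : CAff r n) * (hC r i.next * wC r (j + 1)) *
            (((hRho r n)⁻¹ : (CAff r n)ˣ) : CAff r n) := by
          rw [hh]; simp only [mul_assoc]; rw [hRho_inv_mul_wC]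
      _ = (t' * ((hRho r n : CAff r n) * hC r i.next) + u' * (hRho r n : CAff r n)) *
            (((hRho r n)⁻¹ : (CAff r n)ˣ) : CAff r n) := by
          rw [e, mul_add, ← mul_assoc, e', f', mul_assoc]
      _ = t' * hC r i + u' := by
          rw [add_mul, Units.mul_inv_cancel_right, mul_assoc, ← hh]
  · exact exists_hC_mul_wC_of_ne_zero i hi j

variable (r n) in
/-- The span of the products of elements of `wAlg` and elements `h_ŵ`. -/
noncomputable def whSpan : Submodule (GroundRing r) (CAff r n) :=
  Subalgebra.toSubmodule (wAlg r n) * hSpan r n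

theorem mul_mem_whSpan_of {a : CAff r n}
    (ha : ∀ t ∈ wAlg r n, ∀ x ∈ hSpan r n, a * (t * x) ∈ whSpan r n) {y : CAff r n}
    (hy : y ∈ whSpan r n) : a * y ∈ whSpan r n := by
  induction hy using Submodule.mul_induction_on' with
  | mem_mul_mem t ht x hx => exact ha t ht x hx
  | add x _ y _ hx hy => rw [mul_add]; exact add_mem hx hy

theorem mul_mem_whSpan {t x : CAff r n} (ht : t ∈ wAlg r n) (hx : x ∈ hSpan r n) :
    t * x ∈ whSpan r n := Submodule.mul_mem_mul ht hx

theorem mkAlgHom_mul_mem_whSpan (a : FreeAlgebra (GroundRing r) (CGen n)) {y : CAff r n}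
    (hy : y ∈ whSpan r n) :
    RingQuot.mkAlgHom (GroundRing r) (CRel r n) a * y ∈ whSpan r n := by
  induction a using FreeAlgebra.induction generalizing y with
  | grade0 c =>
    rw [AlgHom.commutes, ← Algebra.smul_def]
    exact Submodule.smul_mem _ _ hy
  | grade1 g =>
    refine mul_mem_whSpan_of (fun t ht x hx => ?_) hy
    cases g with
    | w j =>
      change wC r j * (t * x) ∈ _
      rw [← mul_assoc]
      exact mul_mem_whSpan (mul_mem (wC_mem j) ht) hx
    | h i =>
      change hC r i * (t * x) ∈ _
      obtain ⟨t', ht', u, hu, e⟩ := exists_mul_eq_add_of_mem_wAlg (exists_hC_mul_wC i) ht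
      rw [← mul_assoc, e, add_mul, mul_assoc]
      exact add_mem (mul_mem_whSpan ht' (hC_mul_mem_hSpan i hx)) (mul_mem_whSpan hu hx)
    | rho =>
      change (hRho r n : CAff r n) * (t * x) ∈ _
      obtain ⟨t', ht', e⟩ := exists_hRho_mul ht
      rw [← mul_assoc, e, mul_assoc]
      have := hRho_zpow_mul_mem_hSpan 1 hx
      rw [zpow_one] at this
      exact mul_mem_whSpan ht' this
    | rhoInv =>
      change (((hRho r n)⁻¹ : (CAff r n)ˣ) : CAff r n) * (t * x) ∈ _
      obtain ⟨t', ht', e⟩ := exists_hRho_inv_mul ht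
      rw [← mul_assoc, e, mul_assoc]
      have := hRho_zpow_mul_mem_hSpan (-1) hx
      rw [zpow_neg_one] at this
      exact mul_mem_whSpan ht' this
  | mul a b ha hb => rw [map_mul, mul_assoc]; exact ha (hb hy)
  | add a b ha hb => rw [map_add, add_mul]; exact add_mem (ha hy) (hb hy)

/-- The span contains 1 and is stable under left multiplication by the generators, hence is
everything. -/
theorem whSpan_eq_top : whSpan r n = ⊤ := by
  refine eq_top_iff.mpr fun x _ => ?_
  obtain ⟨a, rfl⟩ := RingQuot.mkAlgHom_surjective (GroundRing r) (CRel r n) x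
  have h1 : (1 : CAff r n) ∈ whSpan r n := by
    have := mul_mem_whSpan (r := r) (n := n) (one_mem _) (hExpr_mem_hSpan 0 [])
    simpa [hExpr] using this
  have := mkAlgHom_mul_mem_whSpan a h1
  rwa [mul_one] at this

/-! ### Reduction to monomials with exponents below r. -/

theorem mul_prod_ofFn {M : Type*} [Monoid M] {N : ℕ} (x : M) (f : Fin N → M)
    (hx : ∀ j, x * f j = f j * x) (k : Fin N) :
    x * (List.ofFn f).prod = (List.ofFn (Function.update f k (x * f k))).prod := by
  induction N with
  | zero => exact k.elim0
  | succ N ih =>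
    rw [List.ofFn_succ, List.prod_cons, List.ofFn_succ, List.prod_cons]
    cases k using Fin.cases with
    | zero => simp [mul_assoc]
    | succ k =>
      rw [← mul_assoc, hx, mul_assoc, ih (fun j => f j.succ) (fun j => hx j.succ) k,
        Function.update_of_ne (Fin.succ_ne_zero k).symm]
      congr 3
      exact (Function.update_comp_eq_of_injective f (Fin.succ_injective N) k _).symm

theorem exists_wC_mul_wMonomial (hn : 1 ≤ n) (hr : 1 ≤ r) (k : ZMod n) (α : Fin n → Fin r) :
    ∃ β, wC r k * wMonomial r α = wMonomial r β := by
  obtain ⟨j, rfl⟩ := (natCast_succ_bijective hn).2 k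
  -- The extra factor is absorbed into the j-th power, and w_j^r = 1 wraps the exponent modulo r.
  refine ⟨Function.update α j ⟨((α j : ℕ) + 1) % r, Nat.mod_lt _ hr⟩, ?_⟩
  rw [wMonomial, mul_prod_ofFn _ _ (fun i => ((show Commute _ _ from wC_comm _ _).pow_right _)) j,
    wMonomial]
  congr 2
  funext i
  by_cases h : i = j
  · subst h
    rw [Function.update_self, Function.update_self, ← pow_succ']
    exact pow_eq_pow_mod _ (wC_pow _)
  · rw [Function.update_of_ne h, Function.update_of_ne h]

theorem wAlg_le_span (hn : 1 ≤ n) (hr : 1 ≤ r) : Subalgebra.toSubmodule (wAlg r n) ≤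
    Submodule.span (GroundRing r) (Set.range (wMonomial (n := n) r)) := by
  intro t ht
  have h1 : (1 : CAff r n) ∈
      Submodule.span (GroundRing r) (Set.range (wMonomial (n := n) r)) := by
    refine Submodule.subset_span ⟨fun _ => ⟨0, hr⟩, ?_⟩
    simp [wMonomial]
  suffices h : ∀ y ∈ Submodule.span (GroundRing r) (Set.range (wMonomial (n := n) r)),
      t * y ∈ Submodule.span (GroundRing r) (Set.range (wMonomial (n := n) r)) by
    simpa using h 1 h1
  change t ∈ Algebra.adjoin _ _ at ht
  induction ht using Algebra.adjoin_induction with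
  | mem a ha =>
    obtain ⟨k, rfl⟩ := ha
    intro y hy
    induction hy using Submodule.span_induction with
    | mem y hy =>
      obtain ⟨α, rfl⟩ := hy
      obtain ⟨β, hβ⟩ := exists_wC_mul_wMonomial hn hr k α
      rw [hβ]
      exact Submodule.subset_span ⟨β, rfl⟩
    | zero => rw [mul_zero]; exact zero_mem _
    | add x y _ _ hx hy => rw [mul_add]; exact add_mem hx hy
    | smul b x _ hx => rw [mul_smul_comm]; exact Submodule.smul_mem _ _ hx
  | algebraMap c =>
    intro y hy
    rw [← Algebra.smul_def]
    exact Submodule.smul_mem _ _ hy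
  | add a b _ _ iha ihb => intro y hy; rw [add_mul]; exact add_mem (iha y hy) (ihb y hy)
  | mul a b _ _ iha ihb => intro y hy; rw [mul_assoc]; exact iha _ (ihb y hy)

theorem span_wMonomial_mul_hElt (hn : 1 ≤ n) (hr : 1 ≤ r) :
    ⊤ ≤ Submodule.span (GroundRing r) (Set.range
      fun p : (Fin n → Fin r) × ExtAffWeyl n => wMonomial r p.1 * hElt r p.2) := by
  rw [← whSpan_eq_top, whSpan]
  refine (mul_le_mul_left (wAlg_le_span hn hr) _).trans ?_
  rw [hSpan, Submodule.span_mul_span]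
  refine Submodule.span_mono ?_
  rintro _ ⟨_, ⟨α, rfl⟩, _, ⟨w, rfl⟩, rfl⟩
  exact ⟨(α, w), rfl⟩

end Spanning

end AffineYokonuma

/-- The element `h_ŵ` does not depend on the reduced expression of `ŵ`, and the elements
`w_1 ^ α_1 ⋯ w_n ^ α_n h_ŵ` form a basis of `Ĉ^aff_{r,n}` over `R`. -/
theorem proposition3p10 (r n : ℕ) (hr : 1 ≤ r) (hn : 1 ≤ n) :
    (∀ (w : AffineYokonuma.ExtAffWeyl n) (k : ℤ) (L : List (AffineYokonuma.Node n)),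
      AffineYokonuma.IsReducedExpression w k L →
        AffineYokonuma.hElt r w = AffineYokonuma.hExpr r k L) ∧
    ∃ b : Module.Basis ((Fin n → Fin r) × AffineYokonuma.ExtAffWeyl n)
        (AffineYokonuma.GroundRing r) (AffineYokonuma.CAff r n),
      ∀ (α : Fin n → Fin r) (w : AffineYokonuma.ExtAffWeyl n),
        b (α, w) = AffineYokonuma.wMonomial r α * AffineYokonuma.hElt r w := by
  refine ⟨fun w k L h => AffineYokonuma.hElt_eq_hExpr h,
    Module.Basis.mk (AffineYokonuma.linearIndependent_wMonomial_mul_hElt hn hr)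
      (AffineYokonuma.span_wMonomial_mul_hElt hn hr), fun α w => ?_⟩
  rw [Module.Basis.mk_apply]
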